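/- Notation. For a real Banach space $X$ let $B_X$ and $S_X$ be its closed unit ball and unit sphere. A slice of $B_X$ is a set $\{x\in B_X: f(x)>\sup f(B_X)-\alpha\}$ with $f\in X^*$ and $\alpha>0$. The space $X$ has the Daugavet property if for every slice $S$ of $B_X$, every $x\in S_X$ and every $\varepsilon>0$ there is $y\in S$ with $\|x-y\|>2-\varepsilon$. For $\alpha>0$ and $n\in\mathbb N$ put $$S^\alpha(X)=\left\{\tfrac{x+y}{2}: x,y\in B_X,\ \|x-y\|\ge\alpha\right\},$$ $$S^\alpha_n(X)=\left\{\sum_{i=1}^n\lambda_i x_i:\ \lambda_i\in[0,1],\ \sum_{i=1}^n\lambda_i=1,\ x_i\in S^\alpha(X)\right\},$$ $$C^\alpha_n(X)=\sup_{x\in S_X}\ \inf_{y\in S^\alpha_n(X)}\|x-y\|\in[0,\infty],$$ where the infimum of the empty set is $+\infty$. Theorem. For every $n\in\mathbb N$ and every $\eta>0$ there is a real Banach space $X$ with the Daugavet property such that $$C_n^{2\eta}(X)\ge\frac{\eta}{8}.$$ Moreover, $X$ can be chosen to be a closed subspace of the real space $L_1(\mu)$, where $\mu$ is the product of countably many copies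 of Lebesgue measure on $[0,1]$, such that $X$ contains the constant function $\mathbf 1$ and $\|\mathbf 1-z\|\ge\frac{\eta}{8}$ for every $z\in S_n^{2\eta}(X)$. -/

import Mathlib

open MeasureTheory

open scoped ENNReal

/-- The slice `S(C, f, α) = {x ∈ C : f x > sup f(C) - α}` of a (bounded) set `C`. -/
def slice {X : Type*} [NormedAddCommGroup X] [NormedSpace ℝ X]
    (C : Set X) (f : X →L[ℝ] ℝ) (α : ℝ) : Set X :=
  {x ∈ C | sSup (f '' C) - α < f x}

/-- The Daugavet property of a real Banach space: for every slice `S` of the closed unit ball,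
every `x` in the unit sphere and every `ε > 0`, some `y ∈ S` satisfies `‖x - y‖ > 2 - ε`. -/
def HasDaugavetProperty (X : Type*) [NormedAddCommGroup X] [NormedSpace ℝ X] : Prop :=
  ∀ (f : X →L[ℝ] ℝ) (α : ℝ), 0 < α → ∀ x ∈ Metric.sphere (0 : X) 1, ∀ ε : ℝ, 0 < ε →
    ∃ y ∈ slice (Metric.closedBall (0 : X) 1) f α, 2 - ε < ‖x - y‖

/-- `conv_n(C)`: the convex combinations of at most `n` elements of `C`. -/
def convN {X : Type*} [NormedAddCommGroup X] [NormedSpace ℝ X] (n : ℕ) (C : Set X) : Set X :=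
  {z | ∃ (c : Fin n → ℝ) (x : Fin n → X), (∀ i, c i ∈ Set.Icc (0 : ℝ) 1) ∧ ∑ i, c i = 1 ∧
    (∀ i, x i ∈ C) ∧ z = ∑ i, c i • x i}

/-- `S^α(X)`: the midpoints of pairs of points of the closed unit ball at distance at
least `α`. -/
def farMidpoints (X : Type*) [NormedAddCommGroup X] [NormedSpace ℝ X] (α : ℝ) : Set X :=
  {z | ∃ x ∈ Metric.closedBall (0 : X) 1, ∃ y ∈ Metric.closedBall (0 : X) 1,
    α ≤ ‖x - y‖ ∧ z = (2⁻¹ : ℝ) • (x + y)}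

/-- `S_n^α(X) = conv_n(S^α(X))`. -/
def farConv (X : Type*) [NormedAddCommGroup X] [NormedSpace ℝ X] (n : ℕ) (α : ℝ) : Set X :=
  convN n (farMidpoints X α)

/-- `C_n^α(X) = sup_{x ∈ S_X} d(x, S_n^α(X))`, as an element of `[0, ∞]`. The distance to the
empty set is `∞`, the infimum of the empty set in `[0, ∞]`. -/
noncomputable def farConvConstant (X : Type*) [NormedAddCommGroup X] [NormedSpace ℝ X]
    (n : ℕ) (α : ℝ) : ℝ≥0∞ :=
  ⨆ x ∈ Metric.sphere (0 : X) 1, ⨅ y ∈ farConv X n α, ENNReal.ofReal ‖x - y‖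

/-- The product of countably many copies of Lebesgue measure on `[0, 1]`. -/
noncomputable def cubeMeasure : Measure (ℕ → unitInterval) :=
  Measure.infinitePi fun _ : ℕ => (volume : Measure unitInterval)

instance cubeMeasure_isProbabilityMeasure : IsProbabilityMeasure cubeMeasure := by
  unfold cubeMeasure
  infer_instance

/-! The space is the L₁-closure of an increasing union of finite-dimensional spaces of bounded
functions on the cube, in which two seemingly conflicting properties coexist. Every function of norm
at most one is, off a set of small measure, nearly constant. Yet every `u` in the union is nearly an
average of functions `u ω * φ k (ω m)` with a fresh coordinate `m` and `φ k ≥ 0` of mean one and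
small support: these have the norm of `u` and are almost disjoint from any given `x` of the same
stage. This yields the Daugavet property (`hasDaugavetProperty_of_dense`).

Near-constancy gives the quantitative bound. If `‖f‖ ≤ 1` and `f` is close in measure to `c`, then
mass about `|c|` is spread out and about `1 - |c|` at most is concentrated, so `‖f - 1‖` is at most
about `2 * (1 - c)` (`norm_sub_one_le`). Two points at distance `2 * η` therefore have constants
with mean at most about `1 - η / 2`. A convex combination of `n` such midpoints stays below about
this value off a small set, since the tolerance may depend on `n` and `η`
(`le_norm_one_sub_of_near_const`).

The heart is a finite family of such `φ k` whose average is near one although every combination `g +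
∑ a k * φ k` is nearly constant in measure, relative to its norm (`exists_isNeedleFamily`). Each `φ
k` averages normalised indicators at many widely separated levels. At a given level, small
coefficients obey the law of large numbers and large ones meet tiny supports; a coefficient is
intermediate at one level at most (`exists_const_near_sum_spikeAverage`). Disjoint spikes are added
so that the norm controls the coefficients (`sum_abs_le_of_spikes`). Multiplying a stage by such
functions of a new coordinate, with summable errors, preserves near-constancy
(`exists_union_of_stages`). -/

open ProbabilityTheory

/-! ### Bounded measurable functions -/

/-- Bounded measurable real functions. -/
def BddMeas {Y : Type*} [MeasurableSpace Y] (f : Y → ℝ) : Prop :=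
  Measurable f ∧ ∃ K : ℝ, ∀ y, |f y| ≤ K

namespace BddMeas

variable {Y Z : Type*} [MeasurableSpace Y] [MeasurableSpace Z] {f g : Y → ℝ}

lemma measurable (hf : BddMeas f) : Measurable f := hf.1

lemma const (c : ℝ) : BddMeas (fun _ : Y => c) := ⟨measurable_const, |c|, fun _ => le_rfl⟩

lemma add (hf : BddMeas f) (hg : BddMeas g) : BddMeas (fun y => f y + g y) := by
  obtain ⟨hf, K, hK⟩ := hf
  obtain ⟨hg, L, hL⟩ := hg
  exact ⟨hf.add hg, K + L, fun y => (abs_add_le _ _).trans (add_le_add (hK y) (hL y))⟩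

lemma mul (hf : BddMeas f) (hg : BddMeas g) : BddMeas (fun y => f y * g y) := by
  obtain ⟨hf, K, hK⟩ := hf
  obtain ⟨hg, L, hL⟩ := hg
  refine ⟨hf.mul hg, K * L, fun y => ?_⟩
  rw [abs_mul]
  exact mul_le_mul (hK y) (hL y) (abs_nonneg _) ((abs_nonneg _).trans (hK y))

lemma const_mul (c : ℝ) (hf : BddMeas f) : BddMeas (fun y => c * f y) := (const c).mul hf

lemma sub (hf : BddMeas f) (hg : BddMeas g) : BddMeas (fun y => f y - g y) := by
  simpa [sub_eq_add_neg] using hf.add (hg.const_mul (-1))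

lemma abs (hf : BddMeas f) : BddMeas (fun y => |f y|) := by
  obtain ⟨hf, K, hK⟩ := hf
  exact ⟨hf.abs, K, fun y => by simpa using hK y⟩

lemma sum {ι : Type*} (s : Finset ι) {f : ι → Y → ℝ} (hf : ∀ i ∈ s, BddMeas (f i)) :
    BddMeas (fun y => ∑ i ∈ s, f i y) := by
  classical
  induction s using Finset.induction_on with
  | empty => simpa using const 0
  | insert a s ha ih =>
    simp_rw [Finset.sum_insert ha]
    exact (hf a (by simp)).add (ih fun i hi => hf i (by simp [hi]))

lemma comp (hf : BddMeas f) {u : Z → Y} (hu : Measurable u) : BddMeas (fun z => f (u z)) := by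
  obtain ⟨hf, K, hK⟩ := hf
  exact ⟨hf.comp hu, K, fun z => hK _⟩

lemma indicator_one {s : Set Y} (hs : MeasurableSet s) : BddMeas (s.indicator fun _ => (1 : ℝ)) :=
  ⟨measurable_const.indicator hs, 1, fun y => by
    by_cases h : y ∈ s <;> simp [h]⟩

lemma memLp (hf : BddMeas f) (p : ℝ≥0∞) (ν : Measure Y) [IsFiniteMeasure ν] : MemLp f p ν := by
  obtain ⟨hf, K, hK⟩ := hf
  exact MemLp.of_bound hf.aestronglyMeasurable K (.of_forall hK)

lemma integrable (hf : BddMeas f) (ν : Measure Y) [IsFiniteMeasure ν] : Integrable f ν :=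
  memLp_one_iff_integrable.1 (hf.memLp 1 ν)

end BddMeas

/-! ### Second moments and the law of large numbers -/

section Needle

variable {Y : Type*} [MeasurableSpace Y] {ν : Measure Y} [IsProbabilityMeasure ν]

/-- Integrate the pointwise inequality `|f| ≤ f ^ 2 / (2 * s) + s / 2`. -/
lemma integral_abs_le_of_integral_sq_le {f : Y → ℝ} (hf : BddMeas f) {s : ℝ} (hs : 0 < s)
    (h : ∫ y, f y ^ 2 ∂ν ≤ s ^ 2) : ∫ y, |f y| ∂ν ≤ s := by
  have hsq : BddMeas fun y => f y ^ 2 := by simpa [pow_two] using hf.mul hf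
  have key : ∫ y, |f y| ∂ν ≤ ∫ y, ((2 * s)⁻¹ * f y ^ 2 + s / 2) ∂ν := by
    refine integral_mono (hf.abs.integrable ν)
      (((hsq.const_mul _).add (BddMeas.const _)).integrable ν) fun y => ?_
    have h1 : 0 ≤ (2 * s)⁻¹ * (|f y| - s) ^ 2 := by positivity
    have h2 : (2 * s)⁻¹ * (|f y| - s) ^ 2 = (2 * s)⁻¹ * f y ^ 2 + s / 2 - |f y| := by
      rw [← sq_abs (f y)]; field_simp; ring
    show |f y| ≤ _
    linarith
  rw [integral_add ((hsq.const_mul _).integrable ν) (integrable_const _), integral_const_mul] at key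
  have : (2 * s)⁻¹ * ∫ y, f y ^ 2 ∂ν ≤ (2 * s)⁻¹ * s ^ 2 := by gcongr
  have h3 : (2 * s)⁻¹ * s ^ 2 = s / 2 := by field_simp
  simp at key
  simp at this h3
  linarith

/-- The weak law of large numbers for weighted sums of bounded nonnegative variables of mean one. -/
lemma integral_abs_sum_centered_le {ι : Type*} (S : Finset ι) {X : ι → Y → ℝ} {B : ℝ}
    (hX : ∀ k, BddMeas (X k)) (hind : Pairwise fun k l => IndepFun (X k) (X l) ν)
    (hmean : ∀ k, ∫ y, X k y ∂ν = 1) (h0 : ∀ k y, 0 ≤ X k y) (hB : ∀ k y, X k y ≤ B)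
    (a : ι → ℝ) {s : ℝ} (hs : 0 < s) (h : B * ∑ k ∈ S, a k ^ 2 ≤ s ^ 2) :
    ∫ y, |∑ k ∈ S, a k * (X k y - 1)| ∂ν ≤ s := by
  have hb : BddMeas fun y => ∑ k ∈ S, a k * (X k y - 1) :=
    .sum S fun k _ => ((hX k).sub (.const 1)).const_mul _
  have hbk : ∀ k, BddMeas fun y => a k * X k y := fun k => (hX k).const_mul _
  refine integral_abs_le_of_integral_sq_le hb hs (le_trans (le_of_eq
    (b := Var[∑ k ∈ S, fun y => a k * X k y; ν]) ?_) (le_trans ?_ h))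
  · rw [variance_eq_integral (by
      have : Measurable (∑ k ∈ S, fun y => a k * X k y) :=
        (Finset.sum_fn S fun k y => a k * X k y) ▸ Finset.measurable_sum S fun k _ =>
          (hbk k).measurable
      exact this.aemeasurable)]
    congr 1
    ext y
    have : ∫ y, (∑ k ∈ S, fun y => a k * X k y) y ∂ν = ∑ k ∈ S, a k := by
      simp only [Finset.sum_apply]
      rw [integral_finsetSum _ fun k _ => (hbk k).integrable ν]
      simp [integral_const_mul, hmean]
    rw [this]
    simp [mul_sub, Finset.sum_sub_distrib]
  · rw [IndepFun.variance_sum (fun k _ => (hbk k).memLp 2 ν), Finset.mul_sum]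
    · refine Finset.sum_le_sum fun k _ => ?_
      rw [variance_const_mul, mul_comm]
      gcongr
      refine (variance_le_expectation_sq (hX k).measurable.aestronglyMeasurable).trans ?_
      -- As `0 ≤ X k ≤ B` and the mean is one, the second moment is at most `B`, not merely `B ^ 2`.
      -- With `B = (p i)⁻¹` this linear bound is what coefficients below `p i * σ` compensate.
      calc ∫ y, (X k ^ 2) y ∂ν ≤ ∫ y, B * X k y ∂ν := by
            refine integral_mono ?_ (((hX k).const_mul B).integrable ν) fun y => ?_
            · have := ((hX k).mul (hX k)).integrable ν
              simpa [pow_two, Pi.mul_def] using this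
            · simp only [Pi.pow_apply, pow_two]
              exact mul_le_mul_of_nonneg_right (hB k y) (h0 k y)
        _ = B := by rw [integral_const_mul, hmean, mul_one]
    · intro k _ l _ hkl
      exact (hind hkl).comp (measurable_const_mul (a k)) (measurable_const_mul (a l))

end Needle

/-! ### Spikes and the lower ℓ₁-estimate -/

section Needle

variable {Y : Type*} [MeasurableSpace Y] {ν : Measure Y} [IsProbabilityMeasure ν]

/-- Disjoint spikes in the functions `φ k` force the lower `ℓ₁`-estimate. -/
lemma sum_abs_le_of_spikes {N : ℕ} {X φ : Fin N → Y → ℝ} {D : Fin N → Set Y} {K q δ : ℝ}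
    (hX : ∀ k, BddMeas (X k)) (hmean : ∀ k, ∫ y, X k y ∂ν = 1)
    (h0 : ∀ k y, 0 ≤ X k y) (hK : ∀ k y, X k y ≤ K)
    (hD : ∀ k, MeasurableSet (D k)) (hdisj : Pairwise fun k l => Disjoint (D k) (D l))
    (hq : 0 < q) (hDq : ∀ k, ν.real (D k) = q) (hδ : 0 < δ) (hδ1 : δ ≤ 1) (hK0 : 0 ≤ K)
    (hNq : N * q * (K + 1) ≤ δ / 2)
    (hφ : ∀ k y, φ k y = (1 - δ) * X k y + δ * q⁻¹ * (D k).indicator (fun _ => (1 : ℝ)) y)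
    (g : ℝ) (a : Fin N → ℝ) :
    ∑ k, |a k| ≤ 4 / δ * ∫ y, |g + ∑ k, a k * φ k y| ∂ν ∧
      |g| ≤ ∫ y, |g + ∑ k, a k * φ k y| ∂ν + ∑ k, |a k| := by
  have hbI : ∀ k, BddMeas ((D k).indicator fun _ => (1 : ℝ)) := fun k => .indicator_one (hD k)
  have hbφ : ∀ k, BddMeas (φ k) := fun k => by
    have := ((hX k).const_mul (1 - δ)).add ((hbI k).const_mul (δ * q⁻¹))
    rwa [show φ k = _ from funext (hφ k)]
  have hb : BddMeas fun y => g + ∑ k, a k * φ k y :=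
    (BddMeas.const g).add (.sum _ fun k _ => (hbφ k).const_mul _)
  have hI : ∀ k, ∫ y, (D k).indicator (fun _ => (1 : ℝ)) y ∂ν = q := fun k => by
    rw [integral_indicator_const _ (hD k), hDq]; simp
  have hφmean : ∀ k, ∫ y, φ k y ∂ν = 1 := fun k => by
    simp_rw [hφ]
    rw [integral_add (((hX k).const_mul _).integrable ν) (((hbI k).const_mul _).integrable ν),
      integral_const_mul, integral_const_mul, hmean, hI]
    field_simp
    ring
  set H := ∫ y, |g + ∑ k, a k * φ k y| ∂ν with hH
  set L := ∑ k, |a k| with hL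
  have hL0 : 0 ≤ L := Finset.sum_nonneg fun _ _ => abs_nonneg _
  have hg : |g| ≤ H + L := by
    have h1 : |∫ y, (g + ∑ k, a k * φ k y) ∂ν| ≤ H := abs_integral_le_integral_abs
    rw [integral_add (integrable_const _)
      ((BddMeas.sum _ fun k _ => (hbφ k).const_mul (a k)).integrable ν),
      integral_finsetSum _ fun k _ => ((hbφ k).const_mul (a k)).integrable ν] at h1
    simp only [integral_const_mul, hφmean, integral_const, probReal_univ, smul_eq_mul, one_mul,
      mul_one] at h1
    have h2 : |∑ k, a k| ≤ L := Finset.abs_sum_le_sum_abs _ _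
    have h3 : |g| ≤ |g + ∑ k, a k| + |∑ k, a k| := by
      simpa using abs_sub (g + ∑ k, a k) (∑ k, a k)
    linarith
  -- On `D k` exactly one spike, of height `δ * q⁻¹`, is active and everything else is at most `|g|
  -- + K * L`. Off the union of the `D k` the left side vanishes.
  have hpt : ∀ y, ∑ k, (δ * q⁻¹ * |a k| - (|g| + K * L)) * (D k).indicator (fun _ => (1 : ℝ)) y
      ≤ |g + ∑ k, a k * φ k y| := fun y => by
    by_cases hy : ∃ k, y ∈ D k
    · obtain ⟨k, hk⟩ := hy
      have hne : ∀ l, l ≠ k → (D l).indicator (fun _ => (1 : ℝ)) y = 0 := fun l hl =>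
        Set.indicator_of_notMem (fun h => Set.disjoint_left.1 (hdisj hl) h hk) _
      rw [Finset.sum_eq_single k (fun l _ hl => by rw [hne l hl, mul_zero]) (by simp),
        Set.indicator_of_mem hk, mul_one]
      have h1 : ∑ l, a l * φ l y = (1 - δ) * ∑ l, a l * X l y + δ * q⁻¹ * a k := by
        have h2 : ∑ l, a l * (D l).indicator (fun _ => (1 : ℝ)) y = a k := by
          rw [Finset.sum_eq_single k (fun l _ hl => by rw [hne l hl, mul_zero]) (by simp),
            Set.indicator_of_mem hk, mul_one]
        rw [← h2, Finset.mul_sum, Finset.mul_sum, ← Finset.sum_add_distrib]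
        exact Finset.sum_congr rfl fun l _ => by rw [hφ]; ring
      have h3 : |∑ l, a l * X l y| ≤ K * L := by
        rw [hL, Finset.mul_sum]
        refine (Finset.abs_sum_le_sum_abs _ _).trans (Finset.sum_le_sum fun l _ => ?_)
        rw [abs_mul, abs_of_nonneg (h0 l y), mul_comm]
        gcongr
        exact hK l y
      have h4 : |(1 - δ) * ∑ l, a l * X l y| ≤ K * L := by
        rw [abs_mul, abs_of_nonneg (by linarith)]
        refine le_trans ?_ h3
        exact mul_le_of_le_one_left (abs_nonneg _) (by linarith)
      have h5 : |δ * q⁻¹ * a k| = δ * q⁻¹ * |a k| := by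
        rw [abs_mul, abs_of_nonneg (by positivity)]
      rw [h1]
      have h6 : |δ * q⁻¹ * a k| ≤ |g + ((1 - δ) * ∑ l, a l * X l y + δ * q⁻¹ * a k)| +
          |g + (1 - δ) * ∑ l, a l * X l y| := by
        have := abs_sub (g + ((1 - δ) * ∑ l, a l * X l y + δ * q⁻¹ * a k))
          (g + (1 - δ) * ∑ l, a l * X l y)
        rwa [show g + ((1 - δ) * ∑ l, a l * X l y + δ * q⁻¹ * a k) -
          (g + (1 - δ) * ∑ l, a l * X l y) = δ * q⁻¹ * a k by ring] at this
      have h7 := abs_add_le g ((1 - δ) * ∑ l, a l * X l y)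
      linarith
    · push Not at hy
      rw [Finset.sum_eq_zero fun k _ => by rw [Set.indicator_of_notMem (hy k), mul_zero]]
      exact abs_nonneg _
  have hint := integral_mono ((BddMeas.sum Finset.univ fun k _ => (hbI k).const_mul
    (δ * q⁻¹ * |a k| - (|g| + K * L))).integrable ν) (hb.abs.integrable ν) hpt
  rw [integral_finsetSum _ fun k _ => ((hbI k).const_mul _).integrable ν] at hint
  simp only [integral_const_mul, hI] at hint
  have hsum : ∑ k, (δ * q⁻¹ * |a k| - (|g| + K * L)) * q = δ * L - N * q * (|g| + K * L) := by
    rw [hL, ← Finset.sum_mul, Finset.sum_sub_distrib, sub_mul, Finset.sum_mul]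
    simp only [Finset.sum_const, Finset.card_univ, Fintype.card_fin, nsmul_eq_mul]
    congr 1
    · rw [Finset.mul_sum]
      exact Finset.sum_congr rfl fun k _ => by field_simp
    · ring
  rw [hsum] at hint
  refine ⟨?_, hg⟩
  have hH0 : 0 ≤ H := integral_nonneg fun _ => abs_nonneg _
  have hNq0 : 0 ≤ N * q := by positivity
  have hNq1 : N * q ≤ 1 := by nlinarith
  -- With `|g| ≤ H + L`, the smallness of `N * q * (K + 1)` absorbs the error into `δ / 2 * L + H`,
  -- leaving `δ / 2 * L ≤ 2 * H`. The resulting constant involves neither `N` nor `K`.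
  have h8 : N * q * (|g| + K * L) ≤ N * q * (H + L + K * L) := by gcongr
  have h9 : N * q * (H + L + K * L) = N * q * H + N * q * (K + 1) * L := by ring
  have h10 : N * q * (K + 1) * L ≤ δ / 2 * L := by gcongr
  have h11 : N * q * H ≤ 1 * H := by gcongr
  rw [div_mul_eq_mul_div, le_div_iff₀ hδ]
  change _ ≤ H at hint
  linarith

end Needle

/-! ### Averages of indicators at separated levels -/

/-- Pairwise independent random variables, uniformly distributed on `[0, 1]`. -/
structure IsUniformFamily {Y κ : Type*} [MeasurableSpace Y] (ν : Measure Y) (U : κ → Y → ℝ) :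
    Prop where
  measurable : ∀ k, Measurable (U k)
  indep : Pairwise fun k l => IndepFun (U k) (U l) ν
  nonneg : ∀ k y, 0 ≤ U k y
  dist : ∀ k, ∀ p : ℝ, 0 ≤ p → p ≤ 1 → ν.real {y | U k y < p} = p

/-- The normalised indicator function of `(-∞, p)`. -/
noncomputable def spike (p t : ℝ) : ℝ := p⁻¹ * (Set.Iio p).indicator (fun _ => 1) t

/-- The average of the normalised indicator functions at the levels `p 0, …, p (M - 1)`. -/
noncomputable def spikeAverage (M : ℕ) (p : ℕ → ℝ) (t : ℝ) : ℝ :=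
  (M : ℝ)⁻¹ * ∑ i ∈ Finset.range M, spike (p i) t

lemma bddMeas_spike (p : ℝ) : BddMeas (spike p) :=
  (BddMeas.indicator_one measurableSet_Iio).const_mul _

lemma spike_nonneg {p : ℝ} (hp : 0 < p) (t : ℝ) : 0 ≤ spike p t :=
  mul_nonneg (by positivity) (Set.indicator_nonneg (fun _ _ => zero_le_one) _)

lemma spike_le {p : ℝ} (hp : 0 < p) (t : ℝ) : spike p t ≤ p⁻¹ :=
  mul_le_of_le_one_right (by positivity)
    (Set.indicator_le' (g := fun _ => (1 : ℝ)) (fun _ _ => le_rfl) (fun _ _ => zero_le_one) _)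

lemma spike_eq_zero {p t : ℝ} (h : p ≤ t) : spike p t = 0 := by
  simp [spike, h]

lemma bddMeas_spikeAverage (M : ℕ) (p : ℕ → ℝ) : BddMeas (spikeAverage M p) :=
  (BddMeas.sum _ fun i _ => bddMeas_spike (p i)).const_mul _

lemma IsUniformFamily.integral_spike {Y κ : Type*} [MeasurableSpace Y] {ν : Measure Y}
    {U : κ → Y → ℝ} (hU : IsUniformFamily ν U)
    (k : κ) {p : ℝ} (hp : 0 < p) (hp1 : p ≤ 1) : ∫ y, spike p (U k y) ∂ν = 1 := by
  have hm : MeasurableSet {y | U k y < p} := hU.measurable k measurableSet_Iio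
  have h1 : ∀ y, spike p (U k y) = p⁻¹ * {y | U k y < p}.indicator (fun _ => (1 : ℝ)) y :=
    fun y => rfl
  simp_rw [h1]
  rw [integral_const_mul, integral_indicator_const _ hm,
    hU.dist k p hp.le hp1]
  simp [hp.ne']

section Needle

variable {Y : Type*} [MeasurableSpace Y] {ν : Measure Y} [IsProbabilityMeasure ν]

/-- A weighted sum of independent copies of `spikeAverage M p` is, up to a small probability, close
to a constant, as soon as the levels `p i` are sufficiently separated. -/
lemma exists_const_near_sum_spikeAverage {N M : ℕ} (hM : 0 < M) {p : ℕ → ℝ} (hp : ∀ i, 0 < p i)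
    (hp1 : ∀ i, p i ≤ 1) {σ T A s ε : ℝ} (hσ : 0 < σ) (hT : 0 < T) (hs : 0 < s) (hε : 0 < ε)
    (hsep : ∀ i j, i < j → p j * T < p i * σ) (hσs : σ * A ≤ s ^ 2)
    {U : Fin N → Y → ℝ} (hU : IsUniformFamily ν U) (a : Fin N → ℝ) (ha : ∑ k, |a k| ≤ A) :
    ∃ c : ℝ, ν.real {y | ε < |∑ k, a k * spikeAverage M p (U k y) - c|} ≤
      M * A / T + (s + A / M) / ε := by
  classical
  -- At level `i`, a coefficient above `p i * T` multiplies an indicator supported on a set of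
  -- measure `p i < |a k| / T`, so these supports are negligible together. Coefficients below `p i *
  -- σ` are treated by second moments. The remaining windows are disjoint for different `i` by
  -- `hsep`, so the intermediate terms total at most `A` and contribute `A / M` to the average over
  -- levels.
  set big : ℕ → Finset (Fin N) := fun i => Finset.univ.filter fun k => p i * T < |a k| with hbig
  set nbig : ℕ → Finset (Fin N) := fun i => Finset.univ.filter fun k => ¬ p i * T < |a k|
    with hnbig
  set small : ℕ → Finset (Fin N) := fun i => (nbig i).filter fun k => |a k| < p i * σ with hsmall
  set mid : ℕ → Finset (Fin N) := fun i => (nbig i).filter fun k => ¬ |a k| < p i * σ with hmid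
  set X : ℕ → Fin N → Y → ℝ := fun i k y => spike (p i) (U k y) with hX
  have hXb : ∀ i k, BddMeas (X i k) := fun i k => (bddMeas_spike (p i)).comp (hU.measurable k)
  have hX0 : ∀ i k y, 0 ≤ X i k y := fun i k y => spike_nonneg (hp i) _
  have hXmean : ∀ i k, ∫ y, X i k y ∂ν = 1 := fun i k => hU.integral_spike k (hp i) (hp1 i)
  set W : Y → ℝ := fun y => (M : ℝ)⁻¹ * ∑ i ∈ Finset.range M,
    (|∑ k ∈ small i, a k * (X i k y - 1)| + ∑ k ∈ mid i, |a k| * X i k y) with hW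
  have hb1 : ∀ i, BddMeas fun y => |∑ k ∈ small i, a k * (X i k y - 1)| := fun i =>
    (BddMeas.sum _ fun k _ => ((hXb i k).sub (.const 1)).const_mul _).abs
  have hb2 : ∀ i, BddMeas fun y => ∑ k ∈ mid i, |a k| * X i k y := fun i =>
    BddMeas.sum _ fun k _ => (hXb i k).const_mul _
  have hWb : BddMeas W := (BddMeas.sum _ fun i _ => (hb1 i).add (hb2 i)).const_mul _
  have hA0 : 0 ≤ A := (Finset.sum_nonneg fun _ _ => abs_nonneg _).trans ha
  have hM' : (0 : ℝ) < M := by exact_mod_cast hM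
  have hsm : ∀ i, ∫ y, |∑ k ∈ small i, a k * (X i k y - 1)| ∂ν ≤ s := fun i => by
    refine integral_abs_sum_centered_le (B := (p i)⁻¹) (small i) (hXb i) ?_ (hXmean i) (hX0 i)
      (fun k y => spike_le (hp i) _) a hs (le_trans ?_ hσs)
    · intro k l hkl
      exact (hU.indep hkl).comp (bddMeas_spike (p i)).measurable (bddMeas_spike (p i)).measurable
    · rw [inv_mul_le_iff₀ (hp i)]
      calc ∑ k ∈ small i, a k ^ 2 ≤ ∑ k ∈ small i, p i * σ * |a k| := by
            refine Finset.sum_le_sum fun k hk => ?_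
            rw [← sq_abs, pow_two]
            exact mul_le_mul_of_nonneg_right (Finset.mem_filter.1 hk).2.le (abs_nonneg _)
        _ ≤ p i * (σ * A) := by
            rw [← Finset.mul_sum, mul_assoc]
            have := hp i
            gcongr
            exact (Finset.sum_le_univ_sum_of_nonneg fun _ => abs_nonneg _).trans ha
  have hmidsum : ∑ i ∈ Finset.range M, ∑ k ∈ mid i, |a k| ≤ A := by
    refine le_trans (le_of_eq
      (b := ∑ k, ∑ i ∈ (Finset.range M).filter fun i => k ∈ mid i, |a k|) ?_)
      (le_trans (Finset.sum_le_sum fun k (_ : k ∈ Finset.univ) => ?_) ha)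
    · simp_rw [Finset.sum_filter]
      rw [Finset.sum_comm]
      refine Finset.sum_congr rfl fun i _ => ?_
      rw [← Finset.sum_filter]
      congr 1
      ext k
      simp
    · rw [Finset.sum_const, nsmul_eq_mul]
      refine mul_le_of_le_one_left (abs_nonneg _) ?_
      have : ((Finset.range M).filter fun i => k ∈ mid i).card ≤ 1 := by
        refine Finset.card_le_one.2 fun i hi j hj => ?_
        simp only [hmid, hnbig, Finset.mem_filter, Finset.mem_univ, true_and, not_lt] at hi hj
        by_contra hne
        rcases lt_or_gt_of_ne hne with h | h
        · have := hsep i j h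
          linarith [hi.2.2, hj.2.1]
        · have := hsep j i h
          linarith [hi.2.1, hj.2.2]
      exact_mod_cast this
  have hWint : ∫ y, W y ∂ν ≤ s + A / M := by
    simp only [hW]
    rw [integral_const_mul, integral_finsetSum _ fun i _ => ((hb1 i).add (hb2 i)).integrable ν,
      inv_mul_le_iff₀ hM']
    calc _ ≤ ∑ i ∈ Finset.range M, (s + ∑ k ∈ mid i, |a k|) := by
          refine Finset.sum_le_sum fun i _ => ?_
          rw [integral_add ((hb1 i).integrable ν) ((hb2 i).integrable ν),
            integral_finsetSum _ fun k _ => ((hXb i k).const_mul _).integrable ν]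
          simp only [integral_const_mul, hXmean, mul_one]
          gcongr
          exact hsm i
      _ ≤ M * (s + A / M) := by
          rw [Finset.sum_add_distrib, mul_add, mul_div_cancel₀ _ hM'.ne']
          simpa using hmidsum
  have hW0 : ∀ y, 0 ≤ W y := fun y => mul_nonneg (by positivity) <| Finset.sum_nonneg fun i _ =>
    add_nonneg (abs_nonneg _) <| Finset.sum_nonneg fun k _ => mul_nonneg (abs_nonneg _) (hX0 i k y)
  -- Only the small coefficients contribute to the constant, through their mean.
  refine ⟨(M : ℝ)⁻¹ * ∑ i ∈ Finset.range M, ∑ k ∈ small i, a k, ?_⟩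
  set bad : Set Y := ⋃ i ∈ Finset.range M, ⋃ k ∈ big i, {y | U k y < p i} with hbad
  have hbadm : ν.real bad ≤ M * A / T := by
    refine (measureReal_biUnion_finset_le _ _).trans ?_
    calc _ ≤ ∑ i ∈ Finset.range M, A / T := by
          refine Finset.sum_le_sum fun i _ => (measureReal_biUnion_finset_le _ _).trans ?_
          calc _ ≤ ∑ k ∈ big i, |a k| / T := by
                refine Finset.sum_le_sum fun k hk => ?_
                rw [hU.dist k _ (hp i).le (hp1 i), le_div_iff₀ hT]
                exact (Finset.mem_filter.1 hk).2.le
            _ ≤ A / T := by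
                rw [← Finset.sum_div]
                gcongr
                exact (Finset.sum_le_univ_sum_of_nonneg fun _ => abs_nonneg _).trans ha
      _ = M * A / T := by simp [mul_div_assoc]
  have hsub : {y | ε < |∑ k, a k * spikeAverage M p (U k y) -
      (M : ℝ)⁻¹ * ∑ i ∈ Finset.range M, ∑ k ∈ small i, a k|} ⊆ bad ∪ {y | ε ≤ W y} := by
    intro y hy
    by_cases hyb : y ∈ bad
    · exact Or.inl hyb
    refine Or.inr (show ε ≤ W y from le_trans (le_of_lt hy) ?_)
    have hzero : ∀ i ∈ Finset.range M, ∀ k ∈ big i, X i k y = 0 := fun i hi k hk => by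
      refine spike_eq_zero (not_lt.1 fun h => hyb ?_)
      simp only [hbad, Set.mem_iUnion]
      exact ⟨i, hi, k, hk, h⟩
    have h1 : ∑ k, a k * spikeAverage M p (U k y) =
        (M : ℝ)⁻¹ * ∑ i ∈ Finset.range M, ∑ k, a k * X i k y := by
      rw [Finset.sum_comm, Finset.mul_sum]
      refine Finset.sum_congr rfl fun k _ => ?_
      rw [← Finset.mul_sum, spikeAverage]
      ring
    have h2 : ∀ i ∈ Finset.range M, ∑ k, a k * X i k y - ∑ k ∈ small i, a k =
        ∑ k ∈ small i, a k * (X i k y - 1) + ∑ k ∈ mid i, a k * X i k y := fun i hi => by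
      rw [← Finset.sum_filter_add_sum_filter_not Finset.univ (fun k => p i * T < |a k|),
        ← Finset.sum_filter_add_sum_filter_not (nbig i) (fun k => |a k| < p i * σ),
        Finset.sum_eq_zero (s := Finset.univ.filter fun k => p i * T < |a k|) fun k hk => by
          rw [hzero i hi k hk, mul_zero]]
      simp only [mul_sub, mul_one, Finset.sum_sub_distrib]
      ring
    rw [h1, ← mul_sub, ← Finset.sum_sub_distrib, abs_mul, abs_of_pos (by positivity)]
    simp only [hW]
    gcongr
    refine (Finset.abs_sum_le_sum_abs _ _).trans (Finset.sum_le_sum fun i hi => ?_)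
    rw [h2 i hi]
    refine (abs_add_le _ _).trans ?_
    gcongr
    refine (Finset.abs_sum_le_sum_abs _ _).trans (Finset.sum_le_sum fun k _ => ?_)
    rw [abs_mul, abs_of_nonneg (hX0 i k y)]
  refine (measureReal_mono hsub).trans ((measureReal_union_le _ _).trans (add_le_add hbadm ?_))
  rw [le_div_iff₀ hε, mul_comm]
  exact (mul_meas_ge_le_integral_of_nonneg (.of_forall hW0) (hWb.integrable ν) ε).trans hWint

end Needle

lemma spikeAverage_nonneg {M : ℕ} {p : ℕ → ℝ} (hp : ∀ i, 0 < p i) (t : ℝ) :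
    0 ≤ spikeAverage M p t :=
  mul_nonneg (by positivity) (Finset.sum_nonneg fun i _ => spike_nonneg (hp i) t)

lemma spikeAverage_le {M : ℕ} (hM : 0 < M) {p : ℕ → ℝ} (hp : ∀ i, 0 < p i) (t : ℝ) :
    spikeAverage M p t ≤ ∑ i ∈ Finset.range M, (p i)⁻¹ := by
  have h0 : 0 ≤ ∑ i ∈ Finset.range M, spike (p i) t :=
    Finset.sum_nonneg fun i _ => spike_nonneg (hp i) t
  have h1 : (M : ℝ)⁻¹ ≤ 1 := inv_le_one_of_one_le₀ (by exact_mod_cast hM)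
  exact (mul_le_of_le_one_left h0 h1).trans (Finset.sum_le_sum fun i _ => spike_le (hp i) t)

lemma spikeAverage_eq_zero {M : ℕ} {p : ℕ → ℝ} {t : ℝ} (h : ∀ i, p i ≤ t) :
    spikeAverage M p t = 0 := by
  simp [spikeAverage, fun i => spike_eq_zero (h i)]

lemma IsUniformFamily.integral_spikeAverage {Y κ : Type*} [MeasurableSpace Y] {ν : Measure Y}
    [IsProbabilityMeasure ν] {U : κ → Y → ℝ} (hU : IsUniformFamily ν U) (k : κ) {M : ℕ}
    (hM : 0 < M) {p : ℕ → ℝ} (hp : ∀ i, 0 < p i) (hp1 : ∀ i, p i ≤ 1) :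
    ∫ y, spikeAverage M p (U k y) ∂ν = 1 := by
  simp only [spikeAverage]
  rw [integral_const_mul, integral_finsetSum _ fun i _ =>
    ((bddMeas_spike (p i)).comp (hU.measurable k)).integrable ν]
  simp only [fun i => hU.integral_spike k (hp i) (hp1 i)]
  have : (M : ℝ) ≠ 0 := by positivity
  simp [this]

/-! ### Construction of needle families -/

/-- A finite family of nonnegative functions of mean one with small supports, whose average is close
to one, whereas each single linear combination is close in measure to a constant. -/
structure IsNeedleFamily {Y : Type*} [MeasurableSpace Y] (ν : Measure Y) {N : ℕ}
    (φ : Fin N → Y → ℝ) (C ε : ℝ) : Prop where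
  pos : 0 < N
  bddMeas : ∀ k, BddMeas (φ k)
  nonneg : ∀ k y, 0 ≤ φ k y
  integral_eq_one : ∀ k, ∫ y, φ k y ∂ν = 1
  support_le : ∀ k, ν.real {y | φ k y ≠ 0} ≤ ε
  average_le : ∫ y, |(N : ℝ)⁻¹ * ∑ k, φ k y - 1| ∂ν ≤ ε
  coeff_le : ∀ (g : ℝ) (a : Fin N → ℝ),
    |g| + ∑ k, |a k| ≤ C * ∫ y, |g + ∑ k, a k * φ k y| ∂ν
  near_const : ∀ (g : ℝ) (a : Fin N → ℝ), ∃ c : ℝ,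
    ν.real {y | ε * ∫ y, |g + ∑ k, a k * φ k y| ∂ν < |g + ∑ k, a k * φ k y - c|} ≤ ε

section Needle

variable {Y : Type*} [MeasurableSpace Y] {ν : Measure Y} [IsProbabilityMeasure ν]

/-- Disjoint sets of equal small measure. -/
lemma IsUniformFamily.exists_disjoint {U : ℕ → Y → ℝ} (hU : IsUniformFamily ν U) (N : ℕ) {q : ℝ}
    (hq : 0 < q) (hNq : N * q ≤ 1) :
    ∃ D : Fin N → Set Y, (∀ k, MeasurableSet (D k)) ∧
      (Pairwise fun k l => Disjoint (D k) (D l)) ∧ ∀ k, ν.real (D k) = q := by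
  have hm : ∀ t : ℝ, MeasurableSet {y | U 0 y < t} := fun t => hU.measurable 0 measurableSet_Iio
  refine ⟨fun k => {y | U 0 y < (k + 1 : ℝ) * q} \ {y | U 0 y < k * q}, fun k =>
    (hm _).diff (hm _), fun k l hkl => ?_, fun k => ?_⟩
  · refine Set.disjoint_left.2 ?_
    rintro y ⟨h1, h2⟩ ⟨h3, h4⟩
    simp only [Set.mem_ofPred_eq, not_lt] at h1 h2 h3 h4
    have h5 : (l : ℝ) < k + 1 := lt_of_mul_lt_mul_right (h4.trans_lt h1) hq.le
    have h6 : (k : ℝ) < l + 1 := lt_of_mul_lt_mul_right (h2.trans_lt h3) hq.le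
    have h7 : (l : ℕ) < k + 1 := by exact_mod_cast h5
    have h8 : (k : ℕ) < l + 1 := by exact_mod_cast h6
    exact hkl (Fin.ext (by omega))
  · have hk : ((k : ℕ) + 1 : ℝ) ≤ N := by exact_mod_cast k.2
    have hk1 : ((k : ℕ) + 1 : ℝ) * q ≤ 1 := (mul_le_mul_of_nonneg_right hk hq.le).trans hNq
    have hk0 : ((k : ℕ) : ℝ) * q ≤ ((k : ℕ) + 1 : ℝ) * q := by nlinarith
    have hsub : {y | U 0 y < (k : ℕ) * q} ⊆ {y | U 0 y < ((k : ℕ) + 1 : ℝ) * q} :=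
      fun y (hy : U 0 y < _) => lt_of_lt_of_le hy hk0
    refine (measureReal_sdiff hsub (hm _)).trans ?_
    rw [hU.dist 0 _ (by positivity) hk1, hU.dist 0 _ (by positivity) (hk0.trans hk1)]
    ring

/-- The spikes bound the coefficients by `4 / δ` times the norm `H`, so after division by `H` they
fall in the range where `hnear` applies. The spikes themselves live on a set of measure at most `N *
q`, invisible in measure, and carry mean `δ` only. -/
lemma isNeedleFamily_of_spikes {N : ℕ} {X φ : Fin N → Y → ℝ} {D : Fin N → Set Y} {K q δ ε : ℝ}
    (hN : 0 < N) (hX : ∀ k, BddMeas (X k)) (hmean : ∀ k, ∫ y, X k y ∂ν = 1)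
    (h0 : ∀ k y, 0 ≤ X k y) (hK : ∀ k y, X k y ≤ K)
    (hD : ∀ k, MeasurableSet (D k)) (hdisj : Pairwise fun k l => Disjoint (D k) (D l))
    (hq : 0 < q) (hDq : ∀ k, ν.real (D k) = q) (hδ : 0 < δ) (hδε : 8 * δ ≤ ε) (hε1 : ε ≤ 1)
    (hK0 : 0 ≤ K) (hNq : N * q * (K + 1) ≤ δ / 2)
    (hφ : ∀ k y, φ k y = (1 - δ) * X k y + δ * q⁻¹ * (D k).indicator (fun _ => (1 : ℝ)) y)
    (hsupp : ∀ k, ν.real {y | X k y ≠ 0} ≤ ε / 2)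
    (hlln : ∫ y, |∑ k, (N : ℝ)⁻¹ * (X k y - 1)| ∂ν ≤ δ)
    (hnear : ∀ b : Fin N → ℝ, ∑ k, |b k| ≤ 4 / δ →
      ∃ c : ℝ, ν.real {y | ε / 2 < |∑ k, b k * X k y - c|} ≤ ε / 2) :
    IsNeedleFamily ν φ (8 / δ + 1) ε := by
  have hN' : (0 : ℝ) < N := by exact_mod_cast hN
  have hNq2 : N * q ≤ δ / 2 := by
    refine le_trans ?_ hNq
    exact le_mul_of_one_le_right (by positivity) (by linarith)
  have hq2 : q ≤ δ / 2 := by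
    refine le_trans ?_ hNq2
    exact le_mul_of_one_le_left hq.le (by exact_mod_cast hN)
  have hDI : ∀ k, BddMeas ((D k).indicator fun _ => (1 : ℝ)) := fun k => .indicator_one (hD k)
  have hDI0 : ∀ k y, 0 ≤ (D k).indicator (fun _ => (1 : ℝ)) y := fun k y =>
    Set.indicator_nonneg (fun _ _ => zero_le_one) _
  have hDint : ∀ k, ∫ y, (D k).indicator (fun _ => (1 : ℝ)) y ∂ν = q := fun k => by
    rw [integral_indicator_const _ (hD k), hDq]; simp
  have hbφ : ∀ k, BddMeas (φ k) := fun k => by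
    rw [show φ k = _ from funext (hφ k)]
    exact ((hX k).const_mul _).add ((hDI k).const_mul _)
  have hspk := sum_abs_le_of_spikes (ν := ν) hX hmean h0 hK hD hdisj hq hDq hδ
    (by linarith) hK0 hNq hφ
  refine ⟨hN, hbφ, fun k y => ?_, fun k => ?_, fun k => ?_, ?_, fun g a => ?_, fun g a => ?_⟩
  · rw [hφ]
    exact add_nonneg (mul_nonneg (by linarith) (h0 k y)) (mul_nonneg (by positivity) (hDI0 k y))
  · simp only [hφ]
    rw [integral_add (((hX k).const_mul _).integrable ν) (((hDI k).const_mul _).integrable ν),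
      integral_const_mul, integral_const_mul, hmean, hDint]
    field_simp
    ring
  · have hsub : {y | φ k y ≠ 0} ⊆ {y | X k y ≠ 0} ∪ D k := fun y hy => by
      by_contra hcon
      obtain ⟨h1, h2⟩ := not_or.1 hcon
      refine hy ?_
      rw [hφ, not_not.1 h1, Set.indicator_of_notMem h2]
      simp
    refine (measureReal_mono hsub).trans ((measureReal_union_le _ _).trans ?_)
    have := hsupp k
    rw [hDq]
    linarith
  · have hb1 : BddMeas fun y => |∑ k, (N : ℝ)⁻¹ * (X k y - 1)| :=
      (BddMeas.sum _ fun k _ => ((hX k).sub (.const 1)).const_mul _).abs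
    have hb2 : BddMeas fun y => ∑ k, (D k).indicator (fun _ => (1 : ℝ)) y :=
      .sum _ fun k _ => hDI k
    calc _ ≤ ∫ y, (|∑ k, (N : ℝ)⁻¹ * (X k y - 1)| +
          (δ * (N : ℝ)⁻¹ * q⁻¹ * ∑ k, (D k).indicator (fun _ => (1 : ℝ)) y + δ)) ∂ν := by
          refine integral_mono ((((BddMeas.sum _ fun k _ => hbφ k).const_mul _).sub
            (.const 1)).abs.integrable ν)
            ((hb1.add ((hb2.const_mul _).add (.const δ))).integrable ν) fun y => ?_
          have h1 : (N : ℝ)⁻¹ * ∑ k, φ k y - 1 = (1 - δ) * ∑ k, (N : ℝ)⁻¹ * (X k y - 1) +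
              (δ * (N : ℝ)⁻¹ * q⁻¹ * ∑ k, (D k).indicator (fun _ => (1 : ℝ)) y - δ) := by
            simp only [hφ]
            rw [Finset.sum_add_distrib, ← Finset.mul_sum, ← Finset.mul_sum, ← Finset.mul_sum,
              Finset.sum_sub_distrib]
            simp only [Finset.sum_const, Finset.card_univ, Fintype.card_fin, nsmul_eq_mul]
            field_simp
            ring
          have h2 : 0 ≤ δ * (N : ℝ)⁻¹ * q⁻¹ * ∑ k, (D k).indicator (fun _ => (1 : ℝ)) y :=
            mul_nonneg (by positivity) (Finset.sum_nonneg fun k _ => hDI0 k y)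
          show |(N : ℝ)⁻¹ * ∑ k, φ k y - 1| ≤ _
          rw [h1]
          refine (abs_add_le _ _).trans (add_le_add ?_ ?_)
          · rw [abs_mul, abs_of_nonneg (by linarith : 0 ≤ 1 - δ)]
            exact mul_le_of_le_one_left (abs_nonneg _) (by linarith)
          · exact abs_le.2 ⟨by linarith, by linarith⟩
      _ ≤ δ + (δ + δ) := by
          rw [integral_add (hb1.integrable ν) (((hb2.const_mul _).add (.const δ)).integrable ν),
            integral_add ((hb2.const_mul _).integrable ν) (integrable_const _), integral_const_mul,
            integral_finsetSum _ fun k _ => (hDI k).integrable ν]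
          simp only [hDint, Finset.sum_const, Finset.card_univ, Fintype.card_fin, nsmul_eq_mul,
            integral_const, probReal_univ, smul_eq_mul, one_mul]
          rw [show δ * (N : ℝ)⁻¹ * q⁻¹ * (N * q) = δ by field_simp]
          linarith
      _ ≤ ε := by linarith
  · obtain ⟨h1, h2⟩ := hspk g a
    have h3 : 0 ≤ ∫ y, |g + ∑ k, a k * φ k y| ∂ν := integral_nonneg fun _ => abs_nonneg _
    -- The bound on `|g|` brings in the coefficient sum a second time, hence the factor two.
    have h4 : 8 / δ = 2 * (4 / δ) := by ring
    rw [h4]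
    linarith
  · obtain ⟨h1, h2⟩ := hspk g a
    set H := ∫ y, |g + ∑ k, a k * φ k y| ∂ν with hH
    have hH0 : 0 ≤ H := integral_nonneg fun _ => abs_nonneg _
    rcases hH0.eq_or_lt with hH0 | hH0
    · rw [← hH0] at h1 h2 ⊢
      have ha : ∀ k, a k = 0 := fun k => by
        have := Finset.single_le_sum (f := fun k => |a k|) (fun _ _ => abs_nonneg _)
          (Finset.mem_univ k)
        exact abs_nonpos_iff.1 (by linarith)
      have hg : g = 0 := abs_nonpos_iff.1 (by linarith)
      refine ⟨0, ?_⟩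
      simp [ha, hg, (by linarith : 0 ≤ ε)]
    · obtain ⟨c, hc⟩ := hnear (fun k => a k / H) (by
        simp only [abs_div, abs_of_pos hH0]
        rwa [← Finset.sum_div, div_le_iff₀ hH0])
      -- Off the sets `D k` the function `φ k` is just `(1 - δ) * X k`.
      refine ⟨g + (1 - δ) * H * c, ?_⟩
      have hsub : {y | ε * H < |g + ∑ k, a k * φ k y - (g + (1 - δ) * H * c)|} ⊆
          (⋃ k ∈ Finset.univ, D k) ∪
            {y | ε / 2 < |∑ k, a k / H * X k y - c|} := by
        intro y hy
        by_cases hyD : y ∈ ⋃ k ∈ Finset.univ, D k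
        · exact Or.inl hyD
        · refine Or.inr ?_
          simp only [Finset.mem_univ, Set.iUnion_true, Set.mem_iUnion, not_exists] at hyD
          have h3 : g + ∑ k, a k * φ k y - (g + (1 - δ) * H * c) =
              (1 - δ) * H * (∑ k, a k / H * X k y - c) := by
            have h4 : ∑ k, a k * φ k y =
                (1 - δ) * H * ∑ k, a k / H * X k y := by
              rw [Finset.mul_sum]
              refine Finset.sum_congr rfl fun k _ => ?_
              rw [hφ, Set.indicator_of_notMem (hyD k)]
              field_simp
              ring
            rw [h4]
            ring
          simp only [Set.mem_ofPred_eq] at hy ⊢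
          rw [h3, abs_mul, abs_of_nonneg (mul_nonneg (by linarith) hH0.le)] at hy
          by_contra hcon
          push Not at hcon
          have h5 : (1 - δ) * H * |∑ k, a k / H * X k y - c| ≤
              1 * H * (ε / 2) := by
            gcongr
            linarith
          nlinarith
      refine (measureReal_mono hsub).trans ((measureReal_union_le _ _).trans ?_)
      have hDle : ν.real (⋃ k ∈ Finset.univ, D k) ≤ N * q :=
        (measureReal_biUnion_finset_le _ _).trans (by simp [hDq])
      linarith

/-- The levels form a geometric sequence whose ratio `r` satisfies `r * T < σ`, which is the
required separation. They depend on `ε` and `A` only, so the number `N` of variables can be chosen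
afterwards. -/
lemma exists_spikeAverage {ε A : ℝ} (hε : 0 < ε) (hε1 : ε ≤ 1) (hA : 0 < A) :
    ∃ (M : ℕ) (p : ℕ → ℝ), 0 < M ∧ (∀ i, 0 < p i) ∧ (∀ i, p i ≤ ε / 2) ∧
      ∀ (N : ℕ) (U : Fin N → Y → ℝ), IsUniformFamily ν U → ∀ b : Fin N → ℝ, ∑ k, |b k| ≤ A →
        ∃ c : ℝ, ν.real {y | ε / 2 < |∑ k, b k * spikeAverage M p (U k y) - c|} ≤ ε / 2 := by
  -- Here `s + A / M ≤ 2 * s = (ε / 4) * (ε / 2)`, so Markov at height `ε / 2` costs `ε / 4`. The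
  -- choice of `T` gives the large coefficients the other `ε / 4`.
  obtain ⟨s, hsdef⟩ : ∃ s : ℝ, s = ε ^ 2 / 16 := ⟨_, rfl⟩
  have hs : 0 < s := by rw [hsdef]; positivity
  obtain ⟨M, hM⟩ := exists_nat_ge (A / s)
  have hM' : (0 : ℝ) < M := lt_of_lt_of_le (by positivity) hM
  have hM0 : 0 < M := by exact_mod_cast hM'
  obtain ⟨T, hTdef⟩ : ∃ T : ℝ, T = 4 * M * A / ε := ⟨_, rfl⟩
  have hT : 0 < T := by rw [hTdef]; positivity
  obtain ⟨σ, hσdef⟩ : ∃ σ : ℝ, σ = s ^ 2 / A := ⟨_, rfl⟩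
  have hσ : 0 < σ := by rw [hσdef]; positivity
  obtain ⟨r, hrdef⟩ : ∃ r : ℝ, r = σ / (σ + T) := ⟨_, rfl⟩
  have hr : 0 < r := by rw [hrdef]; positivity
  have hr1 : r ≤ 1 := by rw [hrdef, div_le_one (by positivity)]; linarith
  have hrT : r * T < σ := by
    rw [hrdef, div_mul_eq_mul_div, div_lt_iff₀ (by positivity)]; nlinarith
  have hp : ∀ i : ℕ, 0 < ε / 2 * r ^ i := fun i => by positivity
  have hp2 : ∀ i : ℕ, ε / 2 * r ^ i ≤ ε / 2 := fun i =>
    mul_le_of_le_one_right (by positivity) (pow_le_one₀ hr.le hr1)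
  have hsep : ∀ i j : ℕ, i < j → ε / 2 * r ^ j * T < ε / 2 * r ^ i * σ := fun i j hij => by
    have h1 : r ^ j ≤ r ^ (i + 1) := pow_le_pow_of_le_one hr.le hr1 hij
    calc ε / 2 * r ^ j * T ≤ ε / 2 * r ^ (i + 1) * T := by gcongr
      _ = ε / 2 * r ^ i * (r * T) := by ring
      _ < ε / 2 * r ^ i * σ := by gcongr
  refine ⟨M, fun i => ε / 2 * r ^ i, hM0, hp, hp2, fun N U hU b hb => ?_⟩
  obtain ⟨c, hc⟩ := exists_const_near_sum_spikeAverage (ν := ν) hM0 hp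
    (fun i => (hp2 i).trans (by linarith)) hσ hT hs (half_pos hε) hsep
    (by rw [hσdef, div_mul_cancel₀ _ hA.ne']) hU b hb
  refine ⟨c, hc.trans ?_⟩
  have e1 : M * A / T = ε / 4 := by rw [hTdef]; field_simp
  have e2 : A / M ≤ s := by
    rw [div_le_iff₀ hM']; rw [div_le_iff₀ hs] at hM; linarith
  have e3 : (s + A / M) / (ε / 2) ≤ ε / 4 := by
    rw [div_le_iff₀ (by positivity)]
    have : s = ε / 4 * (ε / 2) / 2 := by rw [hsdef]; ring
    linarith
  linarith

/-- The order of choices avoids circularity: `δ` fixes the coefficient bound `4 / δ`, hence the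
levels and the sup bound `K`; then `N` is taken large for the law of large numbers, and finally `q`
small in terms of `N` and `K`. -/
lemma exists_isNeedleFamily {U : ℕ → Y → ℝ} (hU : IsUniformFamily ν U) {ε : ℝ} (hε : 0 < ε)
    (hε1 : ε ≤ 1) : ∃ (N : ℕ) (φ : Fin N → Y → ℝ) (C : ℝ), IsNeedleFamily ν φ C ε := by
  obtain ⟨δ, hδdef⟩ : ∃ δ : ℝ, δ = ε / 8 := ⟨_, rfl⟩
  have hδ : 0 < δ := by rw [hδdef]; positivity
  obtain ⟨M, p, hM0, hp, hp2, hnear⟩ := exists_spikeAverage (ν := ν) hε hε1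
    (by positivity : 0 < 4 / δ)
  have hp1 : ∀ i, p i ≤ 1 := fun i => (hp2 i).trans (by linarith)
  obtain ⟨K, hKdef⟩ : ∃ K : ℝ, K = ∑ i ∈ Finset.range M, (p i)⁻¹ := ⟨_, rfl⟩
  have hK0 : 0 ≤ K := hKdef ▸ Finset.sum_nonneg fun i _ => (inv_pos.2 (hp i)).le
  obtain ⟨N, hN⟩ := exists_nat_ge (K / δ ^ 2 + 1)
  have hKN : K ≤ N * δ ^ 2 := by
    have : K / δ ^ 2 ≤ N := by linarith
    rwa [div_le_iff₀ (by positivity)] at this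
  have hN' : (0 : ℝ) < N := lt_of_lt_of_le (by positivity) hN
  have hN0 : 0 < N := by exact_mod_cast hN'
  obtain ⟨q, hqdef⟩ : ∃ q : ℝ, q = δ / (2 * N * (K + 1)) := ⟨_, rfl⟩
  have hq : 0 < q := by rw [hqdef]; positivity
  have hNq : N * q * (K + 1) ≤ δ / 2 := by
    rw [hqdef]; apply le_of_eq; field_simp
  have hNq1 : N * q ≤ 1 := by
    have : N * q ≤ N * q * (K + 1) := le_mul_of_one_le_right (by positivity) (by linarith)
    linarith
  obtain ⟨D, hDm, hDd, hDq⟩ := hU.exists_disjoint N hq hNq1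
  -- The index is shifted because `U 0` already serves to cut out the sets `D k`.
  have hV : IsUniformFamily ν fun (k : Fin N) => U (k + 1) :=
    ⟨fun k => hU.measurable _, fun k l hkl => hU.indep (by simpa [Fin.ext_iff] using hkl),
      fun k => hU.nonneg _, fun k => hU.dist _⟩
  have hX : ∀ k : Fin N, BddMeas fun y => spikeAverage M p (U (k + 1) y) := fun k =>
    (bddMeas_spikeAverage M p).comp (hU.measurable _)
  have hXmean : ∀ k : Fin N, ∫ y, spikeAverage M p (U (k + 1) y) ∂ν = 1 := fun k =>
    hV.integral_spikeAverage k hM0 hp hp1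
  have hX0 : ∀ (k : Fin N) y, 0 ≤ spikeAverage M p (U (k + 1) y) := fun k y =>
    spikeAverage_nonneg hp _
  have hXK : ∀ (k : Fin N) y, spikeAverage M p (U (k + 1) y) ≤ K := fun k y =>
    hKdef ▸ spikeAverage_le hM0 hp _
  refine ⟨N, _, _, isNeedleFamily_of_spikes hN0 hX hXmean hX0 hXK hDm hDd hq hDq hδ
    (by linarith) hε1 hK0 hNq (fun _ _ => rfl) (fun k => ?_) ?_ (hnear N _ hV)⟩
  · have hsub : {y | spikeAverage M p (U (k + 1) y) ≠ 0} ⊆ {y | U (k + 1) y < ε / 2} := by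
      intro y hy
      by_contra hcon
      exact hy (spikeAverage_eq_zero fun i => (hp2 i).trans (not_lt.1 hcon))
    refine (measureReal_mono hsub).trans ?_
    rw [hU.dist _ _ (by positivity) (by linarith)]
  · refine integral_abs_sum_centered_le (ν := ν) Finset.univ (B := K) hX
      (fun k l hkl => (hV.indep hkl).comp (bddMeas_spikeAverage M p).measurable
        (bddMeas_spikeAverage M p).measurable) hXmean hX0 hXK (fun _ => (N : ℝ)⁻¹) hδ ?_
    simp only [Finset.sum_const, Finset.card_univ, Fintype.card_fin, nsmul_eq_mul]
    rw [show K * (N * (N : ℝ)⁻¹ ^ 2) = K / N by field_simp, div_le_iff₀ hN']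
    linarith

end Needle

/-! ### Independent coordinates -/

/-- The unit interval carries a sequence of independent uniformly distributed variables. -/
lemma exists_isUniformFamily_unitInterval :
    ∃ U : ℕ → unitInterval → ℝ, IsUniformFamily volume U := by
  -- Lebesgue measure on the interval maps onto the cube measure. The coordinates pulled back along
  -- `f` are the desired variables.
  obtain ⟨f, hf, hmap⟩ := Measure.exists_measurable_map_eq cubeMeasure
  have hmp : MeasurePreserving f volume cubeMeasure := ⟨hf, hmap⟩
  have heval : ∀ k, MeasurePreserving (fun t => f t k) volume volume := fun k =>
    (measurePreserving_eval_infinitePi (fun _ : ℕ => (volume : Measure unitInterval)) k).comp hmp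
  have hind : iIndepFun (fun k t => f t k) (volume : Measure unitInterval) := by
    rw [iIndepFun_iff_map_fun_eq_infinitePi_map fun k => (heval k).measurable]
    simp only [(heval _).map_eq]
    exact hmap
  refine ⟨fun k t => (f t k : ℝ), fun k => measurable_subtype_coe.comp (heval k).measurable,
    fun k l hkl => (hind.indepFun hkl).comp measurable_subtype_coe measurable_subtype_coe,
    fun k t => (f t k).2.1, fun k p hp hp1 => ?_⟩
  have h1 : {t | ((f t k : unitInterval) : ℝ) < p} =
      (fun t => f t k) ⁻¹' Set.Iio (⟨p, hp, hp1⟩ : unitInterval) := rfl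
  rw [h1, measureReal_def, (heval k).measure_preimage measurableSet_Iio.nullMeasurableSet]
  simp [hp]

section Cube

lemma measurable_update_coord (m : ℕ) :
    Measurable fun z : (ℕ → unitInterval) × unitInterval => Function.update z.1 m z.2 := by
  refine measurable_pi_lambda _ fun j => ?_
  by_cases h : j = m
  · subst h
    simpa using measurable_snd
  · simp only [Function.update_of_ne h]
    exact (measurable_pi_apply j).comp measurable_fst

/-- Replacing one coordinate by an independent copy preserves the product measure. -/
lemma measurePreserving_update_coord (m : ℕ) :
    MeasurePreserving (fun z : (ℕ → unitInterval) × unitInterval => Function.update z.1 m z.2)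
      (cubeMeasure.prod volume) cubeMeasure := by
  refine ⟨measurable_update_coord m, Measure.eq_infinitePi _ fun s t ht => ?_⟩
  classical
  rw [Measure.map_apply (measurable_update_coord m)
    (MeasurableSet.pi s.countable_toSet fun _ _ => ht _)]
  have hpre : (fun z : (ℕ → unitInterval) × unitInterval => Function.update z.1 m z.2) ⁻¹'
      (s : Set ℕ).pi t = ((s.erase m : Finset ℕ) : Set ℕ).pi t ×ˢ
        (if m ∈ s then t m else Set.univ) := by
    ext ⟨ω, x⟩
    simp only [Set.mem_preimage, Set.mem_pi, Set.mem_prod, Finset.mem_coe, Finset.mem_erase]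
    constructor
    · intro h
      refine ⟨fun j hj => by simpa [Function.update_of_ne hj.1] using h j hj.2, ?_⟩
      split_ifs with hm
      · simpa using h m hm
      · trivial
    · rintro ⟨h1, h2⟩ j hj
      by_cases hjm : j = m
      · subst hjm
        simpa [hj] using h2
      · simpa [Function.update_of_ne hjm] using h1 j ⟨hjm, hj⟩
  rw [hpre, Measure.prod_prod, cubeMeasure, Measure.infinitePi_pi _ fun i _ => ht i]
  by_cases hm : m ∈ s
  · rw [if_pos hm, Finset.prod_erase_mul s (fun i => volume (t i)) hm]
  · rw [if_neg hm, Finset.erase_eq_of_notMem hm, measure_univ, mul_one]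

lemma measurePreserving_coord (m : ℕ) :
    MeasurePreserving (fun ω : ℕ → unitInterval => ω m) cubeMeasure volume :=
  measurePreserving_eval_infinitePi (fun _ : ℕ => (volume : Measure unitInterval)) m

lemma BddMeas.comp_update {F : (ℕ → unitInterval) → ℝ} (hF : BddMeas F) (m : ℕ) :
    BddMeas fun z : (ℕ → unitInterval) × unitInterval => F (Function.update z.1 m z.2) :=
  hF.comp (measurable_update_coord m)

lemma integral_update_coord {F : (ℕ → unitInterval) → ℝ} (hF : BddMeas F) (m : ℕ) :
    ∫ z, F (Function.update z.1 m z.2) ∂(cubeMeasure.prod (volume : Measure unitInterval)) =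
      ∫ ω, F ω ∂cubeMeasure := by
  have h := measurePreserving_update_coord m
  conv_rhs => rw [← h.map_eq]
  rw [integral_map h.measurable.aemeasurable hF.measurable.aestronglyMeasurable]

lemma integral_integral_update_coord {F : (ℕ → unitInterval) → ℝ} (hF : BddMeas F) (m : ℕ) :
    ∫ t : unitInterval, ∫ ω, F (Function.update ω m t) ∂cubeMeasure = ∫ ω, F ω ∂cubeMeasure := by
  rw [← integral_update_coord hF m, integral_prod_symm _ ((hF.comp_update m).integrable _)]

/-! ### Stages of the construction -/

/-- The function does not depend on the coordinates with index at least `m`. -/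
def DependsBelow (m : ℕ) (g : (ℕ → unitInterval) → ℝ) : Prop :=
  ∀ j, m ≤ j → ∀ ω t, g (Function.update ω j t) = g ω

lemma DependsBelow.abs {m : ℕ} {g : (ℕ → unitInterval) → ℝ} (hg : DependsBelow m g) :
    DependsBelow m fun ω => |g ω| := fun j hj ω t => by simp only [hg j hj ω t]

/-- Resampling coordinate `m` leaves `g` unchanged and turns the left side into the integral of a
product over a product space. -/
lemma integral_mul_coord {m : ℕ} {g : (ℕ → unitInterval) → ℝ} (hg : BddMeas g)
    (hgm : DependsBelow m g) {w : unitInterval → ℝ} (hw : BddMeas w) :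
    ∫ ω, g ω * w (ω m) ∂cubeMeasure = (∫ ω, g ω ∂cubeMeasure) * ∫ t, w t := by
  rw [← integral_update_coord (hg.mul (hw.comp (measurable_pi_apply m))) m]
  simp only [Function.update_self, hgm m le_rfl]
  exact integral_prod_mul g w

/-- `E` is spanned by finitely many bounded functions of the coordinates with index below `m`, which
satisfy a lower `ℓ₁`-estimate. -/
def IsStage (m : ℕ) (E : Submodule ℝ ((ℕ → unitInterval) → ℝ)) : Prop :=
  ∃ (ι : Type) (_ : Fintype ι) (e : ι → (ℕ → unitInterval) → ℝ) (C : ℝ),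
    E = Submodule.span ℝ (Set.range e) ∧ (∀ i, BddMeas (e i)) ∧ (∀ i, DependsBelow m (e i)) ∧
      ∀ a : ι → ℝ, ∑ i, |a i| ≤ C * ∫ ω, |∑ i, a i * e i ω| ∂cubeMeasure

lemma mem_span_range_iff_exists_sum {Ω ι : Type*} [Fintype ι] {e : ι → Ω → ℝ} {h : Ω → ℝ} :
    h ∈ Submodule.span ℝ (Set.range e) ↔ ∃ a : ι → ℝ, h = fun ω => ∑ i, a i * e i ω := by
  rw [Submodule.mem_span_range_iff_exists_fun]
  refine exists_congr fun a => ?_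
  constructor
  · rintro rfl
    ext ω
    simp
  · rintro rfl
    ext ω
    simp

namespace IsStage

variable {m : ℕ} {E : Submodule ℝ ((ℕ → unitInterval) → ℝ)}

lemma bddMeas (hE : IsStage m E) {g : (ℕ → unitInterval) → ℝ} (hg : g ∈ E) : BddMeas g := by
  obtain ⟨ι, _, e, C, rfl, hb, -, -⟩ := hE
  obtain ⟨a, rfl⟩ := mem_span_range_iff_exists_sum.1 hg
  exact .sum _ fun i _ => (hb i).const_mul _

lemma dependsBelow (hE : IsStage m E) {g : (ℕ → unitInterval) → ℝ} (hg : g ∈ E) :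
    DependsBelow m g := by
  obtain ⟨ι, _, e, C, rfl, -, hd, -⟩ := hE
  obtain ⟨a, rfl⟩ := mem_span_range_iff_exists_sum.1 hg
  intro j hj ω t
  simp only [fun i => hd i j hj ω t]

end IsStage

/-- The constant functions. -/
lemma isStage_const : IsStage 0 (Submodule.span ℝ {fun _ => (1 : ℝ)}) := by
  refine ⟨Unit, inferInstance, fun _ _ => 1, 1, by simp, fun _ => .const 1,
    fun _ _ _ _ _ => rfl, fun a => ?_⟩
  simp

/-- The products of the functions `e i` with functions of the coordinate `m`. -/
def productFamily {ι : Type} {N : ℕ} (m : ℕ) (e : ι → (ℕ → unitInterval) → ℝ)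
    (φ : Fin N → unitInterval → ℝ) : ι × Option (Fin N) → (ℕ → unitInterval) → ℝ
  | (i, none), ω => e i ω
  | (i, some k), ω => e i ω * φ k (ω m)

/-! ### Adding one coordinate -/

section Step

variable {ι : Type} {N m : ℕ} {e : ι → (ℕ → unitInterval) → ℝ}
  {φ : Fin N → unitInterval → ℝ} {C Cφ ε : ℝ}

lemma bddMeas_productFamily (he : ∀ i, BddMeas (e i)) (hφ : ∀ k, BddMeas (φ k))
    (p : ι × Option (Fin N)) : BddMeas (productFamily m e φ p) := by
  obtain ⟨i, _ | k⟩ := p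
  · exact he i
  · exact (he i).mul ((hφ k).comp (measurable_pi_apply m))

lemma dependsBelow_productFamily (hd : ∀ i, DependsBelow m (e i)) (p : ι × Option (Fin N)) :
    DependsBelow (m + 1) (productFamily m e φ p) := by
  intro j hj ω t
  obtain ⟨i, _ | k⟩ := p
  · exact hd i j (by omega) ω t
  · simp only [productFamily]
    rw [hd i j (by omega) ω t, Function.update_of_ne (by omega)]

variable [Fintype ι]

lemma sum_productFamily (a : ι × Option (Fin N) → ℝ) (ω : ℕ → unitInterval) :
    ∑ p, a p * productFamily m e φ p ω =
      ∑ i, e i ω * (a (i, none) + ∑ k, a (i, some k) * φ k (ω m)) := by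
  rw [Fintype.sum_prod_type]
  refine Finset.sum_congr rfl fun i _ => ?_
  rw [Fintype.sum_option, mul_add, Finset.mul_sum]
  simp only [productFamily]
  congr 1
  · ring
  · exact Finset.sum_congr rfl fun k _ => by ring

/-- With coordinate `m` frozen at `t`, the sum is a combination of the `e i` with coefficients `v i
t`, to which `hC` applies. It remains to integrate over `t`. -/
lemma sum_integral_abs_le (he : ∀ i, BddMeas (e i)) (hd : ∀ i, DependsBelow m (e i))
    (hC : ∀ a : ι → ℝ, ∑ i, |a i| ≤ C * ∫ ω, |∑ i, a i * e i ω| ∂cubeMeasure)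
    {v : ι → unitInterval → ℝ} (hv : ∀ i, BddMeas (v i)) :
    ∑ i, ∫ t, |v i t| ≤ C * ∫ ω, |∑ i, e i ω * v i (ω m)| ∂cubeMeasure := by
  have hF : BddMeas fun ω => |∑ i, e i ω * v i (ω m)| :=
    (BddMeas.sum _ fun i _ => (he i).mul ((hv i).comp (measurable_pi_apply m))).abs
  rw [← integral_integral_update_coord hF m, ← integral_const_mul,
    ← integral_finsetSum _ fun i _ => (hv i).abs.integrable volume]
  refine integral_mono (integrable_finsetSum _ fun i _ => (hv i).abs.integrable volume)
    (((hF.comp_update m).integrable _).integral_prod_right.const_mul _) fun t => ?_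
  refine (hC fun i => v i t).trans (le_of_eq ?_)
  simp only [Function.update_self, fun i => hd i m le_rfl]
  simp only [mul_comm]

lemma IsNeedleFamily.const_nonneg {Y : Type*} [MeasurableSpace Y] {ν : Measure Y}
    [IsProbabilityMeasure ν] {ψ : Fin N → Y → ℝ} (hψ : IsNeedleFamily ν ψ Cφ ε) : 0 ≤ Cφ := by
  have := hψ.coeff_le 1 0
  simp at this
  linarith

/-- Lower ℓ₁-estimates multiply: `hC` separates the coefficient functions of the `e i`, and the
needle estimate separates the coefficients within each of them. -/
lemma isStage_productFamily (he : ∀ i, BddMeas (e i)) (hd : ∀ i, DependsBelow m (e i))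
    (hC : ∀ a : ι → ℝ, ∑ i, |a i| ≤ C * ∫ ω, |∑ i, a i * e i ω| ∂cubeMeasure)
    (hφ : IsNeedleFamily volume φ Cφ ε) :
    IsStage (m + 1) (Submodule.span ℝ (Set.range (productFamily m e φ))) := by
  refine ⟨ι × Option (Fin N), inferInstance, _, Cφ * C, rfl,
    bddMeas_productFamily he hφ.bddMeas, dependsBelow_productFamily hd, fun a => ?_⟩
  simp only [sum_productFamily]
  have h1 := sum_integral_abs_le he hd hC
    (v := fun i t => a (i, none) + ∑ k, a (i, some k) * φ k t) fun i =>
      (BddMeas.const _).add (.sum _ fun k _ => (hφ.bddMeas k).const_mul _)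
  rw [mul_assoc]
  refine le_trans ?_ (mul_le_mul_of_nonneg_left h1 hφ.const_nonneg)
  rw [Fintype.sum_prod_type, Finset.mul_sum]
  refine Finset.sum_le_sum fun i _ => ?_
  rw [Fintype.sum_option]
  exact hφ.coeff_le _ _

/-- The elements of the larger space are close in measure to elements of the smaller one. -/
lemma exists_near_of_mem_span_productFamily (he : ∀ i, BddMeas (e i))
    (hd : ∀ i, DependsBelow m (e i))
    (hC : ∀ a : ι → ℝ, ∑ i, |a i| ≤ C * ∫ ω, |∑ i, a i * e i ω| ∂cubeMeasure)
    (hφ : IsNeedleFamily volume φ Cφ ε) (hε : 0 ≤ ε) {K θ : ℝ} (hK0 : 0 ≤ K)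
    (hK : ∀ i ω, |e i ω| ≤ K) (hθ0 : 0 ≤ θ) (hθ1 : θ ≤ 1)
    (h1 : Fintype.card ι * ε ≤ θ / 4) (h2 : K * ε * C ≤ θ / 4) {h : (ℕ → unitInterval) → ℝ}
    (hh : h ∈ Submodule.span ℝ (Set.range (productFamily m e φ))) :
    ∃ g ∈ Submodule.span ℝ (Set.range e),
      ∫ ω, |g ω| ∂cubeMeasure ≤ (1 + θ) * ∫ ω, |h ω| ∂cubeMeasure ∧
      cubeMeasure.real {ω | θ * ∫ ω, |h ω| ∂cubeMeasure < |h ω - g ω|} ≤ θ := by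
  obtain ⟨a, rfl⟩ := mem_span_range_iff_exists_sum.1 hh
  simp only [sum_productFamily]
  obtain ⟨v, hv⟩ : ∃ v : ι → unitInterval → ℝ,
      v = fun i t => a (i, none) + ∑ k, a (i, some k) * φ k t := ⟨_, rfl⟩
  have hvb : ∀ i, BddMeas (v i) := fun i => by
    rw [hv]; exact (BddMeas.const _).add (.sum _ fun k _ => (hφ.bddMeas k).const_mul _)
  have hve : ∀ i t, a (i, none) + ∑ k, a (i, some k) * φ k t = v i t := fun i t => by rw [hv]
  have hnear : ∀ i, ∃ c : ℝ, volume.real {t | ε * ∫ t, |v i t| < |v i t - c|} ≤ ε := fun i => by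
    rw [hv]; exact hφ.near_const _ _
  simp only [hve]
  choose c hc using hnear
  have hsum := sum_integral_abs_le he hd hC hvb
  have hhb : BddMeas fun ω => ∑ i, e i ω * v i (ω m) :=
    .sum _ fun i _ => (he i).mul ((hvb i).comp (measurable_pi_apply m))
  obtain ⟨H, hH⟩ : ∃ H : ℝ, H = ∫ ω, |∑ i, e i ω * v i (ω m)| ∂cubeMeasure := ⟨_, rfl⟩
  rw [← hH] at hsum ⊢
  have hH0 : 0 ≤ H := hH ▸ integral_nonneg fun _ => abs_nonneg _
  -- Off `B` every coefficient function `v i` is near its constant `c i`, with errors whose sum is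
  -- controlled by the norm of `h` through the ℓ₁-estimate.
  obtain ⟨B, hB⟩ : ∃ B : Set unitInterval,
      B = ⋃ i ∈ Finset.univ, {t | ε * ∫ t, |v i t| < |v i t - c i|} := ⟨_, rfl⟩
  have hBm : MeasurableSet B := by
    rw [hB]
    exact Finset.measurableSet_biUnion _ fun i _ => measurableSet_lt measurable_const
      ((hvb i).sub (.const _)).abs.measurable
  have hBle : volume.real B ≤ θ / 4 := by
    rw [hB]
    refine (measureReal_biUnion_finset_le _ _).trans (le_trans (Finset.sum_le_sum fun i _ => hc i) ?_)
    simpa using h1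
  have hgb : BddMeas fun ω => ∑ i, c i * e i ω := .sum _ fun i _ => (he i).const_mul _
  have hgd : DependsBelow m fun ω => |∑ i, c i * e i ω| := fun j hj ω t => by
    simp only [fun i => hd i j hj ω t]
  have hpt : ∀ ω : ℕ → unitInterval, ω m ∉ B →
      |∑ i, e i ω * v i (ω m) - ∑ i, c i * e i ω| ≤ θ / 4 * H := fun ω hω => by
    simp only [hB, Finset.mem_univ, Set.iUnion_true, Set.mem_iUnion, not_exists,
      Set.mem_ofPred_eq, not_lt] at hω
    rw [← Finset.sum_sub_distrib]
    calc _ ≤ ∑ i, K * (ε * ∫ t, |v i t|) := by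
          refine (Finset.abs_sum_le_sum_abs _ _).trans (Finset.sum_le_sum fun i _ => ?_)
          rw [show e i ω * v i (ω m) - c i * e i ω = e i ω * (v i (ω m) - c i) by ring, abs_mul]
          exact mul_le_mul (hK i ω) (hω i) (abs_nonneg _) hK0
      _ = K * ε * ∑ i, ∫ t, |v i t| := by
          rw [Finset.mul_sum]; exact Finset.sum_congr rfl fun i _ => by ring
      _ ≤ K * ε * (C * H) := by gcongr
      _ = K * ε * C * H := by ring
      _ ≤ θ / 4 * H := by gcongr
  refine ⟨fun ω => ∑ i, c i * e i ω, mem_span_range_iff_exists_sum.2 ⟨c, rfl⟩, ?_, ?_⟩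
  -- Closeness in measure yields a norm bound because `g` does not depend on coordinate `m`:
  -- restricting to `ω m ∉ B` multiplies the integral of `|g|` by exactly the measure of the
  -- complement of `B`.
  · have hBc : BddMeas (Bᶜ.indicator fun _ => (1 : ℝ)) := .indicator_one hBm.compl
    have hmul := integral_mul_coord hgb.abs hgd hBc
    rw [integral_indicator_const _ hBm.compl, probReal_compl_eq_one_sub hBm, smul_eq_mul,
      mul_one] at hmul
    have hle : ∫ ω, |∑ i, c i * e i ω| * Bᶜ.indicator (fun _ => (1 : ℝ)) (ω m) ∂cubeMeasure ≤
        ∫ ω, (|∑ i, e i ω * v i (ω m)| + θ / 4 * H) ∂cubeMeasure := by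
      refine integral_mono ((hgb.abs.mul (hBc.comp (measurable_pi_apply m))).integrable _)
        ((hhb.abs.add (.const _)).integrable _) fun ω => ?_
      by_cases hω : ω m ∈ B
      · have : Bᶜ.indicator (fun _ => (1 : ℝ)) (ω m) = 0 := by simp [hω]
        simp only [this, mul_zero]
        positivity
      · have : Bᶜ.indicator (fun _ => (1 : ℝ)) (ω m) = 1 := by simp [hω]
        simp only [this, mul_one]
        have h3 := hpt ω hω
        have h4 := abs_sub_abs_le_abs_sub (∑ i, c i * e i ω) (∑ i, e i ω * v i (ω m))
        rw [abs_sub_comm] at h4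
        linarith
    rw [hmul, integral_add (hhb.abs.integrable _) (integrable_const _), ← hH] at hle
    simp only [integral_const, probReal_univ, smul_eq_mul, one_mul] at hle
    have hG0 : 0 ≤ ∫ ω, |∑ i, c i * e i ω| ∂cubeMeasure := integral_nonneg fun _ => abs_nonneg _
    have h5 : (∫ ω, |∑ i, c i * e i ω| ∂cubeMeasure) * (1 - θ / 4) ≤ (1 + θ / 4) * H := by
      refine le_trans (mul_le_mul_of_nonneg_left (by linarith) hG0) (hle.trans (le_of_eq ?_))
      ring
    have h6 : (1 + θ / 4) * H ≤ (1 + θ) * H * (1 - θ / 4) := by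
      have : 0 ≤ H * (θ * (1 - θ)) := mul_nonneg hH0 (mul_nonneg hθ0 (by linarith))
      nlinarith [mul_nonneg hH0 hθ0]
    exact le_of_mul_le_mul_right (h5.trans h6) (by linarith)
  · have hsub : {ω : ℕ → unitInterval | θ * H < |∑ i, e i ω * v i (ω m) - ∑ i, c i * e i ω|} ⊆
        (fun ω : ℕ → unitInterval => ω m) ⁻¹' B := fun ω hω => by
      by_contra hcon
      have h3 := hpt ω hcon
      have h4 : θ * H < |∑ i, e i ω * v i (ω m) - ∑ i, c i * e i ω| := hω
      nlinarith [mul_nonneg hθ0 hH0]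
    refine (measureReal_mono hsub).trans ?_
    rw [measureReal_def, (measurePreserving_coord m).measure_preimage hBm.nullMeasurableSet,
      ← measureReal_def]
    linarith

/-- Off the support of `w` only `x` is present. On it the triangle inequality loses `2 * |x|`, and
by independence `x` has at most the fraction `ε` of its mass there. -/
lemma integral_abs_sub_mul_ge {x u : (ℕ → unitInterval) → ℝ} (hx : BddMeas x) (hu : BddMeas u)
    (hxm : DependsBelow m x) (hum : DependsBelow m u) {w : unitInterval → ℝ} (hw : BddMeas w)
    (hw0 : ∀ t, 0 ≤ w t) (hw1 : ∫ t, w t = 1) (hwε : volume.real {t | w t ≠ 0} ≤ ε) :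
    ∫ ω, |x ω| ∂cubeMeasure + ∫ ω, |u ω| ∂cubeMeasure - 2 * ε * ∫ ω, |x ω| ∂cubeMeasure ≤
      ∫ ω, |x ω - u ω * w (ω m)| ∂cubeMeasure := by
  have hSm : MeasurableSet {t | w t ≠ 0} := hw.measurable (measurableSet_singleton 0).compl
  obtain ⟨J, hJ⟩ : ∃ J : unitInterval → ℝ, J = {t | w t ≠ 0}.indicator fun _ => (1 : ℝ) := ⟨_, rfl⟩
  have hJb : BddMeas J := hJ ▸ .indicator_one hSm
  have hJi : ∫ t, J t ≤ ε := by
    rw [hJ, integral_indicator_const _ hSm]; simpa using hwε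
  have hev := measurable_pi_apply (X := fun _ : ℕ => unitInterval) m
  have h1 := integral_mul_coord hx.abs hxm.abs hJb (m := m)
  have h2 := integral_mul_coord hu.abs hum.abs hw (m := m)
  have h3 : ∫ ω, (|x ω| + |u ω| * w (ω m) - 2 * (|x ω| * J (ω m))) ∂cubeMeasure ≤
      ∫ ω, |x ω - u ω * w (ω m)| ∂cubeMeasure := by
    refine integral_mono (((hx.abs.add (hu.abs.mul (hw.comp hev))).sub
      ((hx.abs.mul (hJb.comp hev)).const_mul 2)).integrable _)
      ((hx.sub (hu.mul (hw.comp hev))).abs.integrable _) fun ω => ?_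
    show |x ω| + |u ω| * w (ω m) - 2 * (|x ω| * J (ω m)) ≤ |x ω - u ω * w (ω m)|
    by_cases hω : w (ω m) = 0
    · have : J (ω m) = 0 := by simp [hJ, hω]
      simp [this, hω]
    · have : J (ω m) = 1 := by simp [hJ, hω]
      rw [this]
      have h4 := abs_sub_abs_le_abs_sub (u ω * w (ω m)) (x ω)
      rw [abs_mul, abs_of_nonneg (hw0 _), abs_sub_comm] at h4
      linarith
  rw [integral_sub ((hx.abs.add (hu.abs.mul (hw.comp hev))).integrable _)
    (((hx.abs.mul (hJb.comp hev)).const_mul 2).integrable _),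
    integral_add (hx.abs.integrable _) ((hu.abs.mul (hw.comp hev)).integrable _),
    integral_const_mul, h1, h2, hw1, mul_one] at h3
  have h5 : (∫ ω, |x ω| ∂cubeMeasure) * ∫ t, J t ≤ (∫ ω, |x ω| ∂cubeMeasure) * ε := by
    gcongr
  linarith

end Step

/-- The extension of a stage by one coordinate. -/
lemma IsStage.exists_extension {m : ℕ} {E : Submodule ℝ ((ℕ → unitInterval) → ℝ)}
    (hE : IsStage m E) {θ : ℝ} (hθ : 0 < θ) (hθ1 : θ ≤ 1) :
    ∃ E' : Submodule ℝ ((ℕ → unitInterval) → ℝ), E ≤ E' ∧ IsStage (m + 1) E' ∧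
      (∀ h ∈ E', ∃ g ∈ E, ∫ ω, |g ω| ∂cubeMeasure ≤ (1 + θ) * ∫ ω, |h ω| ∂cubeMeasure ∧
        cubeMeasure.real {ω | θ * ∫ ω, |h ω| ∂cubeMeasure < |h ω - g ω|} ≤ θ) ∧
      ∀ u ∈ E, ∃ (N : ℕ) (y : Fin N → (ℕ → unitInterval) → ℝ), 0 < N ∧ (∀ k, y k ∈ E') ∧
        (∀ k, ∫ ω, |y k ω| ∂cubeMeasure = ∫ ω, |u ω| ∂cubeMeasure) ∧
        (∀ k, ∀ x ∈ E, ∫ ω, |x ω| ∂cubeMeasure + ∫ ω, |u ω| ∂cubeMeasure -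
          2 * θ * ∫ ω, |x ω| ∂cubeMeasure ≤ ∫ ω, |x ω - y k ω| ∂cubeMeasure) ∧
        ∫ ω, |(N : ℝ)⁻¹ * ∑ k, y k ω - u ω| ∂cubeMeasure ≤ θ * ∫ ω, |u ω| ∂cubeMeasure := by
  have hEb := fun g hg => hE.bddMeas (g := g) hg
  have hEd := fun g hg => hE.dependsBelow (g := g) hg
  obtain ⟨ι, _, e, C, hspan, he, hd, hC⟩ := hE
  obtain ⟨K, hK0, hK⟩ : ∃ K : ℝ, 0 ≤ K ∧ ∀ i ω, |e i ω| ≤ K := by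
    choose L hL using fun i => (he i).2
    refine ⟨∑ i, |L i|, Finset.sum_nonneg fun _ _ => abs_nonneg _, fun i ω => ?_⟩
    exact (hL i ω).trans ((le_abs_self _).trans
      (Finset.single_le_sum (f := fun i => |L i|) (fun _ _ => abs_nonneg _) (Finset.mem_univ i)))
  have hC' : ∀ a : ι → ℝ, ∑ i, |a i| ≤ |C| * ∫ ω, |∑ i, a i * e i ω| ∂cubeMeasure := fun a =>
    (hC a).trans (mul_le_mul_of_nonneg_right (le_abs_self C) (integral_nonneg fun _ => abs_nonneg _))
  -- The three summands of the denominator serve the union bound over `ι`, the error bound `K * ε *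
  -- |C|`, and `ε ≤ θ`.
  obtain ⟨ε, hεdef⟩ : ∃ ε : ℝ, ε = θ / (4 * (Fintype.card ι + K * |C| + 1)) := ⟨_, rfl⟩
  have hden : (0 : ℝ) < Fintype.card ι + K * |C| + 1 := by positivity
  have hε : 0 < ε := by rw [hεdef]; positivity
  have hεθ : (Fintype.card ι + K * |C| + 1) * ε = θ / 4 := by rw [hεdef]; field_simp
  have hcε : 0 ≤ (Fintype.card ι : ℝ) * ε := by positivity
  have hKε : 0 ≤ K * |C| * ε := by positivity
  have hε1 : ε ≤ θ := by nlinarith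
  obtain ⟨U, hU⟩ := exists_isUniformFamily_unitInterval
  obtain ⟨N, φ, Cφ, hφ⟩ := exists_isNeedleFamily hU hε (hε1.trans hθ1)
  have hle : E ≤ Submodule.span ℝ (Set.range (productFamily m e φ)) := by
    rw [hspan]
    refine Submodule.span_mono ?_
    rintro _ ⟨i, rfl⟩
    exact ⟨(i, none), rfl⟩
  have hmem : ∀ u ∈ E, ∀ k, (fun ω => u ω * φ k (ω m)) ∈
      Submodule.span ℝ (Set.range (productFamily m e φ)) := fun u hu k => by
    rw [hspan] at hu
    obtain ⟨a, rfl⟩ := mem_span_range_iff_exists_sum.1 hu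
    have : (fun ω => (∑ i, a i * e i ω) * φ k (ω m)) =
        ∑ i, a i • productFamily m e φ (i, some k) := by
      ext ω
      simp [Finset.sum_mul, productFamily, mul_assoc]
    rw [this]
    exact Submodule.sum_mem _ fun i _ => Submodule.smul_mem _ _ (Submodule.subset_span ⟨_, rfl⟩)
  refine ⟨_, hle, isStage_productFamily he hd hC' hφ, fun h hh => ?_, fun u hu => ?_⟩
  · rw [hspan]
    exact exists_near_of_mem_span_productFamily he hd hC' hφ hε.le hK0 hK hθ.le hθ1
      (by linarith) (by linarith) hh
  · have hub := hEb u hu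
    have hud := hEd u hu
    have huad := hud.abs
    have hu0 : 0 ≤ ∫ ω, |u ω| ∂cubeMeasure := integral_nonneg fun _ => abs_nonneg _
    refine ⟨N, fun k ω => u ω * φ k (ω m), hφ.pos, hmem u hu, fun k => ?_, fun k x hx => ?_, ?_⟩
    · have := integral_mul_coord hub.abs huad (hφ.bddMeas k)
      rw [hφ.integral_eq_one, mul_one] at this
      rw [← this]
      simp only [abs_mul, abs_of_nonneg (hφ.nonneg k _)]
    · exact integral_abs_sub_mul_ge (hEb x hx) hub (hEd x hx) hud (hφ.bddMeas k) (hφ.nonneg k)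
        (hφ.integral_eq_one k) ((hφ.support_le k).trans hε1)
    · have hb : BddMeas fun t => |(N : ℝ)⁻¹ * ∑ k, φ k t - 1| :=
        (((BddMeas.sum _ fun k _ => hφ.bddMeas k).const_mul _).sub (.const 1)).abs
      have h1 := integral_mul_coord hub.abs huad hb
      have h2 : ∀ ω : ℕ → unitInterval, |(N : ℝ)⁻¹ * ∑ k, u ω * φ k (ω m) - u ω| =
          |u ω| * |(N : ℝ)⁻¹ * ∑ k, φ k (ω m) - 1| := fun ω => by
        rw [← abs_mul, ← Finset.mul_sum]
        congr 1
        ring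
      simp only [h2]
      rw [h1, mul_comm]
      exact mul_le_mul_of_nonneg_right (hφ.average_le.trans hε1) hu0

end Cube

/-! ### The union of the stages -/

/-- The union of a suitable increasing sequence of stages. -/
lemma exists_union_of_stages {ε : ℝ} (hε : 0 < ε) (hε1 : ε ≤ 1) :
    ∃ G : Submodule ℝ ((ℕ → unitInterval) → ℝ), (∀ g ∈ G, BddMeas g) ∧ (fun _ => (1 : ℝ)) ∈ G ∧
      (∀ h ∈ G, ∃ c : ℝ,
        cubeMeasure.real {ω | ε * ∫ ω, |h ω| ∂cubeMeasure < |h ω - c|} ≤ ε) ∧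
      ∀ u ∈ G, ∀ x ∈ G, ∀ τ : ℝ, 0 < τ →
        ∃ (N : ℕ) (y : Fin N → (ℕ → unitInterval) → ℝ), 0 < N ∧ (∀ k, y k ∈ G) ∧
        (∀ k, ∫ ω, |y k ω| ∂cubeMeasure = ∫ ω, |u ω| ∂cubeMeasure) ∧
        (∀ k, ∫ ω, |x ω| ∂cubeMeasure + ∫ ω, |u ω| ∂cubeMeasure -
          τ * ∫ ω, |x ω| ∂cubeMeasure ≤ ∫ ω, |x ω - y k ω| ∂cubeMeasure) ∧
        ∫ ω, |(N : ℝ)⁻¹ * ∑ k, y k ω - u ω| ∂cubeMeasure ≤ τ * ∫ ω, |u ω| ∂cubeMeasure := by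
  have hθ : ∀ m : ℕ, 0 < ε / 2 ^ (m + 2) := fun m => by positivity
  have hθ1 : ∀ m : ℕ, ε / 2 ^ (m + 2) ≤ 1 := fun m =>
    (div_le_self hε.le (one_le_pow₀ (by norm_num))).trans hε1
  let S : ∀ m : ℕ, {E : Submodule ℝ ((ℕ → unitInterval) → ℝ) // IsStage m E} := fun m =>
    Nat.rec ⟨_, isStage_const⟩ (fun m s => ⟨(s.2.exists_extension (hθ m) (hθ1 m)).choose,
      (s.2.exists_extension (hθ m) (hθ1 m)).choose_spec.2.1⟩) m
  have hS := fun m => ((S m).2.exists_extension (hθ m) (hθ1 m)).choose_spec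
  have hSs : ∀ m, (S (m + 1)).1 = ((S m).2.exists_extension (hθ m) (hθ1 m)).choose := fun m => rfl
  obtain ⟨E, hE⟩ : ∃ E : ℕ → Submodule ℝ ((ℕ → unitInterval) → ℝ), E = fun m => (S m).1 :=
    ⟨_, rfl⟩
  have hE0 : E 0 = Submodule.span ℝ {fun _ => (1 : ℝ)} := by rw [hE]; rfl
  have hEst : ∀ m, IsStage m (E m) := fun m => by rw [hE]; exact (S m).2
  have hstep : ∀ m, E m ≤ E (m + 1) ∧
      (∀ h ∈ E (m + 1), ∃ g ∈ E m,
        ∫ ω, |g ω| ∂cubeMeasure ≤ (1 + ε / 2 ^ (m + 2)) * ∫ ω, |h ω| ∂cubeMeasure ∧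
        cubeMeasure.real {ω | ε / 2 ^ (m + 2) * ∫ ω, |h ω| ∂cubeMeasure < |h ω - g ω|} ≤
          ε / 2 ^ (m + 2)) ∧
      ∀ u ∈ E m, ∃ (N : ℕ) (y : Fin N → (ℕ → unitInterval) → ℝ), 0 < N ∧
        (∀ k, y k ∈ E (m + 1)) ∧
        (∀ k, ∫ ω, |y k ω| ∂cubeMeasure = ∫ ω, |u ω| ∂cubeMeasure) ∧
        (∀ k, ∀ x ∈ E m, ∫ ω, |x ω| ∂cubeMeasure + ∫ ω, |u ω| ∂cubeMeasure -
          2 * (ε / 2 ^ (m + 2)) * ∫ ω, |x ω| ∂cubeMeasure ≤ ∫ ω, |x ω - y k ω| ∂cubeMeasure) ∧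
        ∫ ω, |(N : ℝ)⁻¹ * ∑ k, y k ω - u ω| ∂cubeMeasure ≤
          ε / 2 ^ (m + 2) * ∫ ω, |u ω| ∂cubeMeasure := fun m => by
    rw [hE]
    exact ⟨(hS m).1, (hS m).2.2.1, (hS m).2.2.2⟩
  clear_value S
  clear hS hSs hE S
  have hmono : Monotone E := monotone_nat_of_le_succ fun m => (hstep m).1
  have hmem : ∀ g, g ∈ ⨆ m, E m ↔ ∃ m, g ∈ E m := fun g =>
    Submodule.mem_iSup_of_directed _ hmono.directed_le
  refine ⟨⨆ m, E m, fun g hg => ?_, ?_, fun h hh => ?_, fun u hu x hx τ hτ => ?_⟩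
  · obtain ⟨m, hm⟩ := (hmem g).1 hg
    exact (hEst m).bddMeas hm
  · exact (hmem _).2 ⟨0, by rw [hE0]; exact Submodule.subset_span rfl⟩
  · obtain ⟨m, hm⟩ := (hmem h).1 hh
    -- The tolerance at stage `m` is `ε - ε / 2 ^ m`. With `θ = ε / 2 ^ (m + 2)`, the next stage
    -- allows `2 * θ` more: one `θ` for replacing `h` by `g`, one for the factor `1 + θ` in the norm
    -- of `g`.
    have key : ∀ m, ∀ h ∈ E m, ∃ c : ℝ, cubeMeasure.real
        {ω | (ε - ε / 2 ^ m) * ∫ ω, |h ω| ∂cubeMeasure < |h ω - c|} ≤ ε - ε / 2 ^ m := by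
      intro m
      induction m with
      | zero =>
        intro h hh
        rw [hE0] at hh
        obtain ⟨c, rfl⟩ := Submodule.mem_span_singleton.1 hh
        refine ⟨c, ?_⟩
        simp
      | succ m ih =>
        intro h hh
        obtain ⟨g, hg, hgn, hgh⟩ := (hstep m).2.1 h hh
        obtain ⟨c, hc⟩ := ih g hg
        refine ⟨c, ?_⟩
        have hH0 : 0 ≤ ∫ ω, |h ω| ∂cubeMeasure := integral_nonneg fun _ => abs_nonneg _
        generalize ∫ ω, |h ω| ∂cubeMeasure = H at hgn hgh hH0 ⊢
        generalize ∫ ω, |g ω| ∂cubeMeasure = L at hgn hc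
        have e1 : ε / 2 ^ m = 4 * (ε / 2 ^ (m + 2)) := by rw [pow_add]; field_simp; norm_num
        have e2 : ε / 2 ^ (m + 1) = 2 * (ε / 2 ^ (m + 2)) := by
          rw [pow_add, pow_add]; field_simp
        have hθm := hθ m
        have h4 : ε / 2 ^ m ≤ ε := div_le_self hε.le (one_le_pow₀ (by norm_num))
        rw [e1] at hc h4
        rw [e2]
        generalize ε / 2 ^ (m + 2) = θ at *
        have hsub : {ω | (ε - 2 * θ) * H < |h ω - c|} ⊆
            {ω | θ * H < |h ω - g ω|} ∪ {ω | (ε - 4 * θ) * L < |g ω - c|} := by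
          intro ω hω
          by_contra hcon
          simp only [Set.mem_union, Set.mem_ofPred_eq, not_or, not_lt] at hcon hω
          have h1 : |h ω - c| ≤ |h ω - g ω| + |g ω - c| := abs_sub_le _ _ _
          have h2 : (ε - 4 * θ) * L ≤ (ε - 4 * θ) * ((1 + θ) * H) := by gcongr
          have h3 : (ε - 4 * θ) * θ * H ≤ 1 * θ * H := by gcongr; linarith
          nlinarith
        refine (measureReal_mono hsub).trans ((measureReal_union_le _ _).trans ?_)
        linarith
    obtain ⟨c, hc⟩ := key m h hm
    refine ⟨c, le_trans (measureReal_mono fun ω hω => ?_) (hc.trans ?_)⟩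
    · have hω' : ε * ∫ ω, |h ω| ∂cubeMeasure < |h ω - c| := hω
      refine lt_of_le_of_lt (mul_le_mul_of_nonneg_right ?_ (integral_nonneg fun _ => abs_nonneg _)) hω'
      have : 0 < ε / 2 ^ m := by positivity
      linarith
    · have : 0 < ε / 2 ^ m := by positivity
      linarith
  · obtain ⟨m₁, hm₁⟩ := (hmem u).1 hu
    obtain ⟨m₂, hm₂⟩ := (hmem x).1 hx
    obtain ⟨m₃, hm₃⟩ := exists_pow_lt_of_lt_one hτ (by norm_num : (1 / 2 : ℝ) < 1)
    obtain ⟨m, h1, h2, h3⟩ : ∃ m, m₁ ≤ m ∧ m₂ ≤ m ∧ m₃ ≤ m :=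
      ⟨max m₁ (max m₂ m₃), by simp, by simp, by simp⟩
    obtain ⟨N, y, hN, hy, hyn, hyx, hav⟩ := (hstep m).2.2 u (hmono h1 hm₁)
    have hτm : 2 * (ε / 2 ^ (m + 2)) ≤ τ := by
      have h4 : (1 / 2 : ℝ) ^ m ≤ (1 / 2) ^ m₃ := pow_le_pow_of_le_one (by norm_num) (by norm_num) h3
      have h5 : ε / 2 ^ (m + 2) = ε * (1 / 2) ^ m / 4 := by
        rw [pow_add, div_pow, one_pow]; field_simp; norm_num
      have h6 : ε * (1 / 2 : ℝ) ^ m ≤ 1 * (1 / 2) ^ m := by gcongr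
      have h7 : (0 : ℝ) ≤ (1 / 2) ^ m := by positivity
      linarith
    refine ⟨N, y, hN, fun k => (hmem _).2 ⟨_, hy k⟩, hyn, fun k => ?_, hav.trans ?_⟩
    · have h4 : 2 * (ε / 2 ^ (m + 2)) * ∫ ω, |x ω| ∂cubeMeasure ≤ τ * ∫ ω, |x ω| ∂cubeMeasure :=
        mul_le_mul_of_nonneg_right hτm (integral_nonneg fun _ => abs_nonneg _)
      linarith [hyx k x (hmono h2 hm₂)]
    · refine mul_le_mul_of_nonneg_right ?_ (integral_nonneg fun _ => abs_nonneg _)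
      linarith [hθ m]

/-! ### A criterion for the Daugavet property -/

section Daugavet

variable {X : Type*} [NormedAddCommGroup X] [NormedSpace ℝ X]

/-- The criterion produces distance about `‖x‖ + ‖u‖`, so a point of norm one in the slice is
needed. Normalise `u` or `-u`, whichever has nonnegative value under `F`; for `u = 0` use `x` or
`-x`. -/
lemma exists_norm_eq_one_lt_apply (F : X →L[ℝ] ℝ) {x u : X} (hx : ‖x‖ = 1) (hu : ‖u‖ ≤ 1) {b : ℝ}
    (hb : b < F u) : ∃ v : X, ‖v‖ = 1 ∧ b < F v := by
  have key : ∀ w : X, w ≠ 0 → ‖w‖ ≤ 1 → 0 ≤ F w → b < F w → ∃ v : X, ‖v‖ = 1 ∧ b < F v := by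
    intro w hw0 hw1 hFw hbw
    have hpos : 0 < ‖w‖ := norm_pos_iff.2 hw0
    refine ⟨‖w‖⁻¹ • w, by rw [norm_smul, norm_inv, norm_norm, inv_mul_cancel₀ hpos.ne'], ?_⟩
    rw [map_smul, smul_eq_mul]
    exact hbw.trans_le (le_mul_of_one_le_left hFw ((one_le_inv₀ hpos).2 hw1))
  by_cases hu0 : u = 0
  · subst hu0
    rw [map_zero] at hb
    rcases le_total 0 (F x) with h | h
    · exact ⟨x, hx, hb.trans_le h⟩
    · exact ⟨-x, by rwa [norm_neg], by rw [map_neg]; linarith⟩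
  · rcases le_total 0 (F u) with h | h
    · exact key u hu0 hu h hb
    · exact key (-u) (neg_ne_zero.2 hu0) (by rwa [norm_neg]) (by rw [map_neg]; linarith)
        (by rw [map_neg]; linarith)

/-- A sufficient condition for the Daugavet property, in terms of a dense subspace. -/
lemma hasDaugavetProperty_of_dense (S : Submodule ℝ X)
    (hS : ∀ x : X, ∀ τ : ℝ, 0 < τ → ∃ s ∈ S, ‖x - s‖ < τ)
    (h : ∀ u ∈ S, ∀ x ∈ S, ∀ τ : ℝ, 0 < τ → ∃ (N : ℕ) (y : Fin N → X), 0 < N ∧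
      (∀ k, ‖y k‖ = ‖u‖) ∧ (∀ k, ‖x‖ + ‖u‖ - τ * ‖x‖ ≤ ‖x - y k‖) ∧
      ‖(N : ℝ)⁻¹ • ∑ k, y k - u‖ ≤ τ * ‖u‖) : HasDaugavetProperty X := by
  intro F α hα x hx ε hε
  have hx1 : ‖x‖ = 1 := by simpa using hx
  obtain ⟨b, hb⟩ : ∃ b, b = sSup (F '' Metric.closedBall (0 : X) 1) - α := ⟨_, rfl⟩
  obtain ⟨u₀, hu₀, hFu₀⟩ : ∃ v : X, ‖v‖ = 1 ∧ b < F v := by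
    obtain ⟨_, ⟨u, hu, rfl⟩, hbu⟩ := exists_lt_of_lt_csSup
      (⟨F 0, 0, by simp, rfl⟩ : (F '' Metric.closedBall (0 : X) 1).Nonempty)
      (by rw [hb]; linarith : b < sSup (F '' Metric.closedBall (0 : X) 1))
    exact exists_norm_eq_one_lt_apply F hx1 (by simpa using hu) hbu
  obtain ⟨τ, hτ0, hτ1, hτε, hτF⟩ : ∃ τ : ℝ, 0 < τ ∧ τ ≤ 1 ∧ 6 * τ ≤ ε ∧
      3 * τ * (‖F‖ + 1) ≤ F u₀ - b := by
    have hF : 0 < ‖F‖ + 1 := by positivity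
    refine ⟨min 1 (min (ε / 6) ((F u₀ - b) / (3 * (‖F‖ + 1)))), ?_, min_le_left _ _, ?_, ?_⟩
    · exact lt_min one_pos (lt_min (by positivity) (div_pos (by linarith) (by positivity)))
    · have : min 1 (min (ε / 6) ((F u₀ - b) / (3 * (‖F‖ + 1)))) ≤ ε / 6 :=
        (min_le_right _ _).trans (min_le_left _ _)
      linarith
    · have : min 1 (min (ε / 6) ((F u₀ - b) / (3 * (‖F‖ + 1)))) ≤ (F u₀ - b) / (3 * (‖F‖ + 1)) :=
        (min_le_right _ _).trans (min_le_right _ _)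
      rw [le_div_iff₀ (by positivity)] at this
      linarith
  obtain ⟨u, huS, hu⟩ := hS u₀ τ hτ0
  obtain ⟨w, hwS, hw⟩ := hS x τ hτ0
  -- The approximant `u` may leave the unit ball by up to `τ`; rescaling brings it back.
  obtain ⟨v, hv⟩ : ∃ v, v = (1 + τ)⁻¹ • u := ⟨_, rfl⟩
  have hvS : v ∈ S := hv ▸ S.smul_mem _ huS
  have hτi : (0 : ℝ) < 1 + τ := by linarith
  have hv1 : ‖v‖ ≤ 1 := by
    rw [hv, norm_smul, norm_inv, Real.norm_of_nonneg hτi.le, inv_mul_le_iff₀ hτi]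
    have := norm_sub_norm_le u u₀
    rw [norm_sub_rev] at this
    linarith
  have hvu : ‖u₀ - v‖ ≤ 2 * τ := by
    have h1 : (1 + τ) • (u₀ - v) = (u₀ - u) + τ • u₀ := by
      rw [hv, smul_sub, smul_inv_smul₀ hτi.ne', add_smul, one_smul]; abel
    have h2 : (1 + τ) * ‖u₀ - v‖ ≤ 2 * τ := by
      rw [← Real.norm_of_nonneg hτi.le, ← norm_smul, h1]
      refine (norm_add_le _ _).trans ?_
      rw [norm_smul, Real.norm_of_nonneg hτ0.le, hu₀]
      linarith
    nlinarith [norm_nonneg (u₀ - v)]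
  have hv2 : 1 - 2 * τ ≤ ‖v‖ := by
    have := norm_sub_norm_le u₀ v
    linarith
  have hw2 : 1 - τ ≤ ‖w‖ := by
    have := norm_sub_norm_le x w
    linarith
  obtain ⟨N, y, hN, hyn, hyw, hav⟩ := h v hvS w hwS τ hτ0
  have hN' : (0 : ℝ) < N := by exact_mod_cast hN
  have hFavg : b < F ((N : ℝ)⁻¹ • ∑ k, y k) := by
    have h1 : |F ((N : ℝ)⁻¹ • ∑ k, y k - v)| ≤ ‖F‖ * τ := by
      refine (F.le_opNorm _).trans (mul_le_mul_of_nonneg_left (hav.trans ?_) (norm_nonneg _))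
      exact mul_le_of_le_one_right hτ0.le hv1
    have h2 : |F (u₀ - v)| ≤ ‖F‖ * (2 * τ) :=
      (F.le_opNorm _).trans (mul_le_mul_of_nonneg_left hvu (norm_nonneg _))
    rw [map_sub] at h1 h2
    have h3 := (abs_le.1 h1).1
    have h4 := (abs_le.1 h2).2
    nlinarith
  -- Since `F` exceeds `b` at the average, it does so at one of the averaged points.
  obtain ⟨k, hk⟩ : ∃ k, b < F (y k) := by
    by_contra! hcon
    rw [map_smul, map_sum, smul_eq_mul] at hFavg
    have h1 : ∑ k, F (y k) ≤ N * b := by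
      refine (Finset.sum_le_sum fun k _ => hcon k).trans (le_of_eq ?_)
      simp
    have h2 : (N : ℝ)⁻¹ * ∑ k, F (y k) ≤ (N : ℝ)⁻¹ * (N * b) := by gcongr
    rw [inv_mul_cancel_left₀ hN'.ne'] at h2
    linarith
  refine ⟨y k, ⟨by simpa [hyn] using hv1, by rw [← hb]; exact hk⟩, ?_⟩
  have h1 := hyw k
  have h2 : ‖w - y k‖ ≤ ‖x - y k‖ + ‖x - w‖ := by
    have := norm_sub_le (x - y k) (x - w)
    rwa [show x - y k - (x - w) = w - y k by abel] at this
  nlinarith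

end Daugavet

/-! ### Consequences of being close in measure to a constant -/

lemma measurableSet_lt_abs_sub_const {Ω : Type*} [MeasurableSpace Ω] {μ : Measure Ω} (f : Lp ℝ 1 μ) (c ε : ℝ) :
    MeasurableSet {ω | ε < |f ω - c|} :=
  measurableSet_lt measurable_const
    (((Lp.stronglyMeasurable f).measurable.sub measurable_const).abs)

section NearConstant

variable {Ω : Type*} [MeasurableSpace Ω] {μ : Measure Ω} [IsProbabilityMeasure μ]

lemma norm_sub_const_eq (f : Lp ℝ 1 μ) (c : ℝ) : ‖f - Lp.const 1 μ c‖ = ∫ ω, |f ω - c| ∂μ := by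
  rw [L1.norm_eq_integral_norm]
  refine integral_congr_ae ?_
  filter_upwards [Lp.coeFn_sub f (Lp.const 1 μ c), Lp.coeFn_const (p := 1) (μ := μ) (c := c)]
    with ω h1 h2
  rw [h1, Pi.sub_apply, h2, Real.norm_eq_abs, Function.const_apply]

lemma integrable_abs_sub_const (f : Lp ℝ 1 μ) (c : ℝ) : Integrable (fun ω => |f ω - c|) μ :=
  ((L1.integrable_coeFn f).sub (integrable_const c)).abs

/-- An element of the unit ball of `L₁` that is close in measure to the constant `c` is, in norm,
close to the constant one if `c` is close to one. -/
lemma norm_sub_one_le {f : Lp ℝ 1 μ} (hf : ‖f‖ ≤ 1) {c ε : ℝ} (hε : 0 ≤ ε) (hε1 : ε ≤ 1 / 4)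
    (hc : μ.real {ω | ε < |f ω - c|} ≤ ε) :
    ‖f - Lp.const 1 μ (1 : ℝ)‖ ≤ 2 * (1 - c) + 10 * ε := by
  obtain ⟨B, hB⟩ : ∃ B, B = {ω | ε < |f ω - c|} := ⟨_, rfl⟩
  have hBm : MeasurableSet B := hB ▸ measurableSet_lt_abs_sub_const f c ε
  rw [← hB] at hc
  have hf' : ∫ ω, |f ω| ∂μ ≤ 1 := by
    rw [L1.norm_eq_integral_norm] at hf; simpa only [Real.norm_eq_abs] using hf
  have hfi : Integrable (fun ω => |f ω|) μ := (L1.integrable_coeFn f).abs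
  have hJb : BddMeas (B.indicator fun _ => (1 : ℝ)) := .indicator_one hBm
  have hJi : ∫ ω, B.indicator (fun _ => (1 : ℝ)) ω ∂μ = μ.real B := by
    rw [integral_indicator_const _ hBm]; simp
  have hP0 : 0 ≤ μ.real B := measureReal_nonneg
  have hc1 : (|c| - ε) * (1 - μ.real B) ≤ 1 := by
    refine le_trans ?_ hf'
    have : ∫ ω, ((|c| - ε) * (1 - B.indicator (fun _ => (1 : ℝ)) ω)) ∂μ ≤ ∫ ω, |f ω| ∂μ := by
      refine integral_mono ((((BddMeas.const 1).sub hJb).const_mul _).integrable μ) hfi fun ω => ?_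
      by_cases hω : ω ∈ B
      · simp [hω]
      · have h1 : |f ω - c| ≤ ε := by rw [hB] at hω; exact not_lt.1 hω
        have h2 := abs_sub_abs_le_abs_sub c (f ω)
        rw [abs_sub_comm] at h2
        simp only [Set.indicator_of_notMem hω, sub_zero, mul_one]
        linarith
    rwa [integral_const_mul, integral_sub (integrable_const _) (hJb.integrable μ), hJi,
      integral_const, probReal_univ, one_smul] at this
  -- Compare `|f - 1|` with `|f|`: the excess is at most one on `B`, and at most `|c - 1| - |c| + 2
  -- * ε` off `B`.
  have hn : ‖f - Lp.const 1 μ (1 : ℝ)‖ ≤ 1 + (|c - 1| - |c| + 2 * ε) * (1 - μ.real B) + μ.real B := by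
    rw [norm_sub_const_eq]
    calc _ ≤ ∫ ω, (|f ω| + ((|c - 1| - |c| + 2 * ε) * (1 - B.indicator (fun _ => (1 : ℝ)) ω) +
          B.indicator (fun _ => (1 : ℝ)) ω)) ∂μ := by
          refine integral_mono (integrable_abs_sub_const f 1) (hfi.add
            (((((BddMeas.const 1).sub hJb).const_mul _).add hJb).integrable μ)) fun ω => ?_
          by_cases hω : ω ∈ B
          · have := abs_sub (f ω) 1
            rw [abs_one] at this
            simpa [hω] using this
          · have h1 : |f ω - c| ≤ ε := by rw [hB] at hω; exact not_lt.1 hω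
            have h2 := abs_sub_abs_le_abs_sub c (f ω)
            rw [abs_sub_comm] at h2
            have h3 := abs_sub_le (f ω) c 1
            simp only [Set.indicator_of_notMem hω, sub_zero, mul_one, add_zero]
            linarith
      _ ≤ _ := by
          rw [integral_add hfi (((((BddMeas.const 1).sub hJb).const_mul _).add hJb).integrable μ),
            integral_add ((((BddMeas.const 1).sub hJb).const_mul _).integrable μ)
            (hJb.integrable μ), integral_const_mul,
            integral_sub (integrable_const _) (hJb.integrable μ), hJi, integral_const,
            probReal_univ, one_smul]
          linarith
  generalize μ.real B = P at *
  rcases le_total c 0 with h0 | h0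
  · rw [abs_of_nonpos h0, abs_of_nonpos (by linarith : c - 1 ≤ 0)] at hn
    nlinarith
  · rw [abs_of_nonneg h0] at hn hc1
    rcases le_total c 1 with h1 | h1
    · rw [abs_of_nonpos (by linarith : c - 1 ≤ 0)] at hn
      nlinarith
    · rw [abs_of_nonneg (by linarith : 0 ≤ c - 1)] at hn
      -- The norm bound lets `c` exceed one by `3 * ε` only, which the term `10 * ε` absorbs.
      have h2 : (c - ε) * (1 - ε) ≤ 1 := le_trans (by gcongr; linarith) hc1
      have h3 : c ≤ 1 + 3 * ε := by nlinarith
      nlinarith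

/-- If every element of the unit ball of a subspace `X` of `L₁` is close in measure to a constant,
then the constant one is far from short convex combinations of midpoints of distant points. -/
lemma le_norm_one_sub_of_near_const {X : Submodule ℝ (Lp ℝ 1 μ)} {n : ℕ} {η ε : ℝ}
    (hη1 : η ≤ 1) (hε : 0 < ε) (hεη : 100 * (n + 1) * ε ≤ η)
    (hX : ∀ f ∈ X, ‖f‖ ≤ 1 → ∃ c : ℝ, μ.real {ω | ε < |f ω - c|} ≤ ε)
    (hone : Lp.const 1 μ (1 : ℝ) ∈ X) {z : X} (hz : z ∈ farConv X n (2 * η)) :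
    η / 8 ≤ ‖(⟨Lp.const 1 μ (1 : ℝ), hone⟩ : X) - z‖ := by
  obtain ⟨l, w, hl, hlsum, hw, rfl⟩ := hz
  choose x hx y hy hxy hwxy using hw
  have hx1 : ∀ i, ‖(x i : Lp ℝ 1 μ)‖ ≤ 1 := fun i => by simpa using hx i
  have hy1 : ∀ i, ‖(y i : Lp ℝ 1 μ)‖ ≤ 1 := fun i => by simpa using hy i
  choose c hc using fun i => hX _ (x i).2 (hx1 i)
  choose d hd using fun i => hX _ (y i).2 (hy1 i)
  have hn0 : (0 : ℝ) ≤ n := Nat.cast_nonneg n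
  have hε4 : 100 * ε ≤ η := by nlinarith
  have hε4' : 100 * (n * ε) ≤ η := by nlinarith
  -- Two points near the constant one are near each other, so distance `2 * η` forces the two
  -- constants down on average.
  have hcd : ∀ i, (c i + d i) / 2 ≤ 1 - η / 2 + 5 * ε := fun i => by
    have h1 := norm_sub_one_le (hx1 i) hε.le (by linarith) (hc i)
    have h2 := norm_sub_one_le (hy1 i) hε.le (by linarith) (hd i)
    have h3 : ‖(x i : Lp ℝ 1 μ) - y i‖ ≤ ‖(x i : Lp ℝ 1 μ) - Lp.const 1 μ (1 : ℝ)‖ +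
        ‖(y i : Lp ℝ 1 μ) - Lp.const 1 μ (1 : ℝ)‖ := by
      have := norm_sub_le ((x i : Lp ℝ 1 μ) - Lp.const 1 μ (1 : ℝ))
        ((y i : Lp ℝ 1 μ) - Lp.const 1 μ (1 : ℝ))
      rwa [sub_sub_sub_cancel_right] at this
    have h4 : 2 * η ≤ ‖(x i : Lp ℝ 1 μ) - y i‖ := hxy i
    linarith
  -- The length `n` matters only here: the `2 * n` exceptional sets must have small total measure.
  obtain ⟨B, hB⟩ : ∃ B : Set Ω, B = ⋃ i ∈ (Finset.univ : Finset (Fin n)),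
      ({ω | ε < |(x i : Lp ℝ 1 μ) ω - c i|} ∪ {ω | ε < |(y i : Lp ℝ 1 μ) ω - d i|}) := ⟨_, rfl⟩
  have hBm : MeasurableSet B := by
    rw [hB]
    exact Finset.measurableSet_biUnion _ fun i _ => (measurableSet_lt_abs_sub_const _ _ _).union
      (measurableSet_lt_abs_sub_const _ _ _)
  have hBle : μ.real B ≤ 2 * (n * ε) := by
    rw [hB]
    refine (measureReal_biUnion_finset_le _ _).trans
      ((Finset.sum_le_sum (g := fun _ => 2 * ε) fun i _ => ?_).trans (le_of_eq ?_))
    · refine (measureReal_union_le _ _).trans ?_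
      linarith [hc i, hd i]
    · simp; ring
  obtain ⟨Z, hZ⟩ : ∃ Z : Lp ℝ 1 μ, Z = ∑ i, l i • ((2⁻¹ : ℝ) • ((x i : Lp ℝ 1 μ) + y i)) := ⟨_, rfl⟩
  have hnorm : ‖(⟨Lp.const 1 μ (1 : ℝ), hone⟩ : X) - ∑ i, l i • w i‖ =
      ∫ ω, |Z ω - 1| ∂μ := by
    rw [← norm_sub_const_eq, norm_sub_rev, hZ]
    change ‖((∑ i, l i • w i - ⟨Lp.const 1 μ (1 : ℝ), hone⟩ : X) : Lp ℝ 1 μ)‖ = _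
    simp [hwxy]
  have hZae : ∀ᵐ ω ∂μ, Z ω =
      ∑ i, l i * (2⁻¹ * ((x i : Lp ℝ 1 μ) ω + (y i : Lp ℝ 1 μ) ω)) := by
    have h1 : ∀ᵐ ω ∂μ, ∀ i, (l i • ((2⁻¹ : ℝ) • ((x i : Lp ℝ 1 μ) + (y i : Lp ℝ 1 μ))) : Lp ℝ 1 μ) ω =
        l i * (2⁻¹ * ((x i : Lp ℝ 1 μ) ω + (y i : Lp ℝ 1 μ) ω)) := by
      rw [ae_all_iff]
      intro i
      filter_upwards [Lp.coeFn_smul (l i) ((2⁻¹ : ℝ) • ((x i : Lp ℝ 1 μ) + (y i : Lp ℝ 1 μ))),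
        Lp.coeFn_smul (2⁻¹ : ℝ) ((x i : Lp ℝ 1 μ) + (y i : Lp ℝ 1 μ)), Lp.coeFn_add (x i : Lp ℝ 1 μ) (y i : Lp ℝ 1 μ)]
        with ω h1 h2 h3
      rw [h1, Pi.smul_apply, h2, Pi.smul_apply, h3, Pi.add_apply, smul_eq_mul, smul_eq_mul]
    filter_upwards [h1, Lp.coeFn_fun_finsetSum Finset.univ
      fun i => l i • ((2⁻¹ : ℝ) • ((x i : Lp ℝ 1 μ) + (y i : Lp ℝ 1 μ)))] with ω h1 h2
    rw [hZ, h2]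
    exact Finset.sum_congr rfl fun i _ => h1 i
  have hJb : BddMeas (Bᶜ.indicator fun _ => (1 : ℝ)) := .indicator_one hBm.compl
  have hlow : ∫ ω, (η / 2 - 6 * ε) * Bᶜ.indicator (fun _ => (1 : ℝ)) ω ∂μ ≤
      ∫ ω, |Z ω - 1| ∂μ := by
    refine integral_mono_ae ((hJb.const_mul _).integrable μ) (integrable_abs_sub_const Z 1) ?_
    filter_upwards [hZae] with ω hω
    by_cases hωB : ω ∈ B
    · have : Bᶜ.indicator (fun _ => (1 : ℝ)) ω = 0 := by simp [hωB]
      rw [this, mul_zero]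
      exact abs_nonneg _
    · have : Bᶜ.indicator (fun _ => (1 : ℝ)) ω = 1 := by simp [hωB]
      rw [this, mul_one, hω]
      simp only [hB, Finset.mem_univ, Set.iUnion_true, Set.mem_iUnion, Set.mem_union,
        Set.mem_ofPred_eq, not_exists, not_or, not_lt] at hωB
      have h1 : ∑ i, l i * (2⁻¹ * ((x i : Lp ℝ 1 μ) ω + (y i : Lp ℝ 1 μ) ω)) ≤
          ∑ i, l i * (1 - η / 2 + 6 * ε) := by
        refine Finset.sum_le_sum fun i _ => mul_le_mul_of_nonneg_left ?_ (hl i).1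
        have h2 := (abs_le.1 (hωB i).1).2
        have h3 := (abs_le.1 (hωB i).2).2
        linarith [hcd i]
      rw [← Finset.sum_mul, hlsum, one_mul] at h1
      refine le_trans ?_ (neg_le_abs _)
      linarith
  rw [integral_const_mul, integral_indicator_const _ hBm.compl, probReal_compl_eq_one_sub hBm,
    smul_eq_mul, mul_one] at hlow
  rw [hnorm]
  refine le_trans ?_ hlow
  generalize μ.real B = P at *
  have h5 : 44 / 100 * η ≤ η / 2 - 6 * ε := by linarith
  have h6 : 98 / 100 ≤ 1 - P := by linarith
  calc η / 8 ≤ 44 / 100 * η * (98 / 100) := by linarith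
    _ ≤ _ := by gcongr; linarith

/-- The unit ball has diameter at most two; for `n = 0` the weights cannot sum to one. -/
lemma farConv_eq_empty_of_one_lt {X : Type*} [NormedAddCommGroup X] [NormedSpace ℝ X] {n : ℕ}
    {η : ℝ} (hη : 1 < η) : farConv X n (2 * η) = ∅ := by
  refine Set.eq_empty_of_forall_notMem fun z hz => ?_
  obtain ⟨l, w, hl, hlsum, hw, rfl⟩ := hz
  rcases isEmpty_or_nonempty (Fin n) with hn | ⟨⟨i⟩⟩
  · simp at hlsum
  · obtain ⟨x, hx, y, hy, hxy, -⟩ := hw i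
    have := norm_sub_le x y
    rw [mem_closedBall_zero_iff] at hx hy
    linarith

end NearConstant

/-! ### Passage to the closure in L₁ -/

section Closure

variable {Ω : Type*} [MeasurableSpace Ω] {μ : Measure Ω} [IsProbabilityMeasure μ]

/-- The classes in `L₁` of a space of bounded measurable functions. -/
noncomputable def bddToLp (μ : Measure Ω) [IsProbabilityMeasure μ] (G : Submodule ℝ (Ω → ℝ))
    (hG : ∀ g ∈ G, BddMeas g) : G →ₗ[ℝ] Lp ℝ 1 μ where
  toFun g := ((hG g g.2).memLp 1 μ).toLp (g : Ω → ℝ)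
  map_add' _ _ := rfl
  map_smul' _ _ := rfl

lemma norm_bddToLp {G : Submodule ℝ (Ω → ℝ)} (hG : ∀ g ∈ G, BddMeas g) (g : G) :
    ‖bddToLp μ G hG g‖ = ∫ ω, |(g : Ω → ℝ) ω| ∂μ :=
  L1.norm_of_fun_eq_integral_norm ((hG g g.2).integrable μ)

/-- Approximate within `ε ^ 2` in norm. Markov's inequality costs `ε` in value and in measure, and
the approximant has norm at most two, which costs `2 * ε` more in value. -/
lemma near_const_of_mem_closure {G : Submodule ℝ (Ω → ℝ)} (hG : ∀ g ∈ G, BddMeas g) {ε : ℝ}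
    (hε : 0 < ε) (hε1 : ε ≤ 1)
    (hnear : ∀ h ∈ G, ∃ c : ℝ, μ.real {ω | ε * ∫ ω, |h ω| ∂μ < |h ω - c|} ≤ ε) {f : Lp ℝ 1 μ}
    (hf : f ∈ (LinearMap.range (bddToLp μ G hG)).topologicalClosure) (hf1 : ‖f‖ ≤ 1) :
    ∃ c : ℝ, μ.real {ω | 3 * ε < |f ω - c|} ≤ 3 * ε := by
  obtain ⟨_, ⟨g, rfl⟩, hfg⟩ := Metric.mem_closure_iff.1 hf (ε ^ 2) (by positivity)
  rw [dist_eq_norm] at hfg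
  obtain ⟨c, hc⟩ := hnear g g.2
  rw [← norm_bddToLp (μ := μ) hG g] at hc
  have hgn : ‖bddToLp μ G hG g‖ ≤ 1 + ε ^ 2 := by
    have := norm_sub_norm_le (bddToLp μ G hG g) f
    rw [norm_sub_rev] at this
    linarith
  have hgae : (bddToLp μ G hG g : Lp ℝ 1 μ) =ᵐ[μ] (g : Ω → ℝ) :=
    MemLp.coeFn_toLp ((hG g g.2).memLp 1 μ)
  have hmarkov : μ.real {ω | ε ≤ |f ω - (g : Ω → ℝ) ω|} ≤ ε := by
    have hint : ∫ ω, |f ω - (g : Ω → ℝ) ω| ∂μ ≤ ε ^ 2 := by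
      refine le_trans (le_of_eq ?_) hfg.le
      rw [L1.norm_eq_integral_norm]
      refine integral_congr_ae ?_
      filter_upwards [Lp.coeFn_sub f (bddToLp μ G hG g), hgae] with ω h1 h2
      rw [h1, Pi.sub_apply, h2, Real.norm_eq_abs]
    have h1 := mul_meas_ge_le_integral_of_nonneg (μ := μ)
      (f := fun ω => |f ω - (g : Ω → ℝ) ω|) (.of_forall fun _ => abs_nonneg _)
      ((L1.integrable_coeFn f).sub ((hG g g.2).integrable μ)).abs ε
    have h2 : ε * μ.real {ω | ε ≤ |f ω - (g : Ω → ℝ) ω|} ≤ ε * ε := by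
      refine h1.trans (hint.trans (le_of_eq ?_)); ring
    exact le_of_mul_le_mul_left h2 hε
  refine ⟨c, ?_⟩
  have hsub : {ω | 3 * ε < |f ω - c|} ⊆ {ω | ε ≤ |f ω - (g : Ω → ℝ) ω|} ∪
      {ω | ε * ‖bddToLp μ G hG g‖ < |(g : Ω → ℝ) ω - c|} := by
    intro ω hω
    by_contra hcon
    simp only [Set.mem_union, Set.mem_ofPred_eq, not_or, not_lt, not_le] at hcon hω
    have h1 := abs_sub_le (f ω) ((g : Ω → ℝ) ω) c
    have h2 : ε * ‖bddToLp μ G hG g‖ ≤ ε * (1 + 1) := by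
      refine mul_le_mul_of_nonneg_left (hgn.trans ?_) hε.le
      nlinarith
    linarith
  refine (measureReal_mono hsub).trans ((measureReal_union_le _ _).trans ?_)
  linarith

lemma hasDaugavetProperty_closure {G : Submodule ℝ (Ω → ℝ)} (hG : ∀ g ∈ G, BddMeas g)
    (h : ∀ u ∈ G, ∀ x ∈ G, ∀ τ : ℝ, 0 < τ → ∃ (N : ℕ) (y : Fin N → Ω → ℝ), 0 < N ∧
      (∀ k, y k ∈ G) ∧ (∀ k, ∫ ω, |y k ω| ∂μ = ∫ ω, |u ω| ∂μ) ∧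
      (∀ k, ∫ ω, |x ω| ∂μ + ∫ ω, |u ω| ∂μ - τ * ∫ ω, |x ω| ∂μ ≤ ∫ ω, |x ω - y k ω| ∂μ) ∧
      ∫ ω, |(N : ℝ)⁻¹ * ∑ k, y k ω - u ω| ∂μ ≤ τ * ∫ ω, |u ω| ∂μ) :
    HasDaugavetProperty (LinearMap.range (bddToLp μ G hG)).topologicalClosure := by
  obtain ⟨R, hR⟩ : ∃ R, R = LinearMap.range (bddToLp μ G hG) := ⟨_, rfl⟩
  rw [← hR]
  have hle := R.le_topologicalClosure
  have hΛ : ∀ g : G, bddToLp μ G hG g ∈ R.topologicalClosure := fun g =>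
    hle (hR ▸ LinearMap.mem_range_self _ g)
  refine hasDaugavetProperty_of_dense (R.comap R.topologicalClosure.subtype) (fun x τ hτ => ?_)
    ?_
  · obtain ⟨s, hs, hxs⟩ := Metric.mem_closure_iff.1 x.2 τ hτ
    exact ⟨⟨s, hle hs⟩, hs, by rwa [dist_eq_norm] at hxs⟩
  · rintro ⟨u, huR⟩ hu ⟨x, hxR⟩ hx τ hτ
    change u ∈ R at hu
    change x ∈ R at hx
    rw [hR] at hu hx
    obtain ⟨u, rfl⟩ := hu
    obtain ⟨x, rfl⟩ := hx
    obtain ⟨N, y, hN, hy, hyn, hyx, hav⟩ := h u u.2 x x.2 τ hτ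
    refine ⟨N, fun k => ⟨bddToLp μ G hG ⟨y k, hy k⟩, hΛ _⟩, hN, fun k => ?_, fun k => ?_, ?_⟩
    · change ‖bddToLp μ G hG ⟨y k, hy k⟩‖ = ‖bddToLp μ G hG u‖
      rw [norm_bddToLp, norm_bddToLp]
      exact hyn k
    · have h1 : ‖bddToLp μ G hG x - bddToLp μ G hG ⟨y k, hy k⟩‖ =
          ∫ ω, |(x : Ω → ℝ) ω - y k ω| ∂μ := by
        rw [← map_sub, norm_bddToLp]
        rfl
      change ‖bddToLp μ G hG x‖ + ‖bddToLp μ G hG u‖ - τ * ‖bddToLp μ G hG x‖ ≤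
        ‖bddToLp μ G hG x - bddToLp μ G hG ⟨y k, hy k⟩‖
      rw [h1, norm_bddToLp, norm_bddToLp]
      exact hyx k
    · have h1 : ‖(N : ℝ)⁻¹ • ∑ k, bddToLp μ G hG ⟨y k, hy k⟩ - bddToLp μ G hG u‖ =
          ∫ ω, |(N : ℝ)⁻¹ * ∑ k, y k ω - (u : Ω → ℝ) ω| ∂μ := by
        rw [← map_sum, ← map_smul, ← map_sub, norm_bddToLp]
        simp
      change ‖((((N : ℝ)⁻¹ • ∑ k, ⟨bddToLp μ G hG ⟨y k, hy k⟩, hΛ _⟩ -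
        ⟨bddToLp μ G hG u, huR⟩ : R.topologicalClosure)) : Lp ℝ 1 μ)‖ ≤ τ * ‖bddToLp μ G hG u‖
      simp only [AddSubgroupClass.coe_sub, Submodule.coe_smul, Submodule.coe_sum, norm_bddToLp, h1]
      exact hav

end Closure

/-! ### The theorem -/

theorem mainTheorem5 (n : ℕ) (η : ℝ) (hη : 0 < η) :
    ∃ (X : Submodule ℝ (Lp ℝ 1 cubeMeasure)) (hone : Lp.const 1 cubeMeasure (1 : ℝ) ∈ X),
      IsClosed (X : Set (Lp ℝ 1 cubeMeasure)) ∧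
      HasDaugavetProperty X ∧
      ENNReal.ofReal (η / 8) ≤ farConvConstant X n (2 * η) ∧
      ∀ z ∈ farConv X n (2 * η),
        η / 8 ≤ ‖(⟨Lp.const 1 cubeMeasure (1 : ℝ), hone⟩ : X) - z‖ := by
  -- The factor three anticipates the loss in passing to the closure.
  obtain ⟨ε, hε0, hε1, hεη⟩ : ∃ ε : ℝ, 0 < ε ∧ ε ≤ 1 ∧ 100 * (n + 1) * (3 * ε) ≤ η := by
    have hn : (0 : ℝ) < 300 * (n + 1) := by positivity
    refine ⟨min 1 (η / (300 * (n + 1))), lt_min one_pos (by positivity), min_le_left _ _, ?_⟩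
    have := min_le_right 1 (η / (300 * (n + 1)))
    rw [le_div_iff₀ hn] at this
    linarith
  obtain ⟨G, hG, hone, hnear, hdaug⟩ := exists_union_of_stages hε0 hε1
  have honeX : Lp.const 1 cubeMeasure (1 : ℝ) ∈
      (LinearMap.range (bddToLp cubeMeasure G hG)).topologicalClosure :=
    Submodule.le_topologicalClosure _ ⟨⟨_, hone⟩, rfl⟩
  have hfar : ∀ z ∈ farConv (LinearMap.range (bddToLp cubeMeasure G hG)).topologicalClosure n
      (2 * η), η / 8 ≤ ‖(⟨Lp.const 1 cubeMeasure (1 : ℝ), honeX⟩ :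
        (LinearMap.range (bddToLp cubeMeasure G hG)).topologicalClosure) - z‖ := by
    intro z hz
    rcases lt_or_ge 1 η with h1 | h1
    · rw [farConv_eq_empty_of_one_lt h1] at hz
      exact hz.elim
    · exact le_norm_one_sub_of_near_const h1 (by positivity) hεη
        (fun f hf hf1 => near_const_of_mem_closure hG hε0 hε1 hnear hf hf1) honeX hz
  refine ⟨_, honeX, Submodule.isClosed_topologicalClosure _, hasDaugavetProperty_closure hG hdaug,
    ?_, hfar⟩
  have hsphere : (⟨Lp.const 1 cubeMeasure (1 : ℝ), honeX⟩ :
      (LinearMap.range (bddToLp cubeMeasure G hG)).topologicalClosure) ∈ Metric.sphere 0 1 := by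
    rw [mem_sphere_zero_iff_norm]
    change ‖Lp.const 1 cubeMeasure (1 : ℝ)‖ = 1
    refine (Lp.norm_const (μ := cubeMeasure) (p := 1) (c := (1 : ℝ)) one_ne_zero).trans ?_
    simp
  refine le_trans ?_ (le_iSup₂ (f := fun x (_ : x ∈ Metric.sphere _ _) =>
    ⨅ y ∈ farConv _ n (2 * η), ENNReal.ofReal ‖x - y‖) _ hsphere)
  exact le_iInf₂ fun y hy => ENNReal.ofReal_le_ofReal (hfar y hy)
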